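/- Let $p,q\in\mathbb C$ with $0<|p|,|q|<1$. Put $(z;q)_\infty=\prod_{j\ge0}(1-zq^j)$, $\theta(z;p)=(z;p)_\infty(p/z;p)_\infty$, $$\Gamma(z)=\prod_{i,j\ge 0}\frac{1-z^{-1}p^{i+1}q^{j+1}}{1-zp^iq^j},\qquad \theta(z)_n=\prod_{j=0}^{n-1}\theta(zq^j;p)\ (n\ge0),\qquad \theta(z)_n=\prod_{j=1}^{-n}\frac1{\theta(zq^{-j};p)}\ (n<0),$$ $\kappa=(p;p)_\infty(q;q)_\infty/(4\pi \mathrm i)$, and, with a product over all sign choices understood in $\pm$, $$K_{t}(x,z)=\frac{\Gamma(tx^{\pm1}z^{\pm1})}{\Gamma(t^2)\,\Gamma(z^{\pm2})},\qquad M_{nm}(a,k)=\frac{\theta(k)_{n+m}\,\theta(k/a)_{n-m}}{\theta(qa)_{n+m}\,\theta(q)_{n-m}}\;\frac{\theta(aq^{2m};p)}{\theta(a;p)}\,a^{n-m}.$$ Let $N\ge0$ be an integer, $a,k\in\mathbb C\setminus\{0\}$ with fixed square roots $a^{1/2},k^{1/2}$, and set $z_0=a^{1/2}$, $t=k^{1/2}/a^{1/2}$,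 $x_\epsilon=\epsilon^{-1}k^{1/2}q^N$. Assume $|z_0|<1$ and the genericity conditions, for all integers $i,j\ge0$: $$q^i\ne p^j\ (1\le i\le N),\quad \tfrac ka q^ip^j\ne1,\quad \tfrac ka\neq q^{i+1}p^{j+1},\quad kq^ip^j\ne1,\quad aq^{2N}\ne q^ip^j,\quad k^2q^{2N}q^ip^j\ne a .$$ Let $\alpha$ be holomorphic on $\mathbb C\setminus\{0\}$ except for at most simple poles at the points $z_0q^m$, $m=0,\dots,N$, and at their reciprocals, with $\alpha(1/z)=\alpha(z)$, and let $\tilde\alpha_m=\lim_{z\to z_0q^m}(1-z_0q^m/z)\,\alpha(z)$. The elliptic Fourier transform of $\alpha$ is $\beta(x)=M(t)_{xz}\alpha(z)=\kappa\int_C K_t(x,z)\,\alpha(z)\,\frac{dz}{z}$. Here $C$ is any contour (a finite sum of closed piecewise $C^1$ curves of finite length) that meets no pole and has winding number $1$ about $0$, about all $tx^{\pm1}q^ip^j$ ($i,j\ge0$) and about all $z_0q^m$ ($0\le m\le N$), and winding number $0$ about the reciprocals of the points $tx^{\pm1}q^ip^j$, $z_0q^m$; if $|tx|,|t/x|<1$,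 the unit circle is such a contour. Call $C'$ a deformed contour at $x$ if it satisfies the same conditions except that it has winding number $0$ about the points $z_0q^m$ and $1$ about their reciprocals, $0\le m\le N$. Then: 1. For all $\epsilon\ne1$ in a neighbourhood of $1$ in $\mathbb C$, $\beta(x_\epsilon)$ is well defined: such contours $C$ exist, and the integral does not depend on the choice. 2. Deformed contours at $x_1$ exist. If $C'$ is one of them, then for all $\epsilon\neq1$ close enough to $1$ it is a deformed contour at $x_\epsilon$ and $$\beta(x_\epsilon)=\kappa\int_{C'}K_t(x_\epsilon,z)\,\alpha(z)\,\frac{dz}{z}+4\pi \mathrm i\,\kappa\sum_{m=0}^N K_t(x_\epsilon,z_0q^m)\,\tilde\alpha_m ,$$ and $(1-\epsilon)\,\kappa\int_{C'}K_t(x_\epsilon,z)\,\alpha(z)\,\frac{dz}{z}\to0$ as $\epsilon\to1$. 3. The limit $\tilde\beta_N=\lim_{\epsilon\to1}(1-\epsilon)\,\beta(x_\epsilon)$ exists, and with $\beta_N=q^{-N(N+1)}\tilde\beta_N$ and $\alpha_m=q^{-m(m+1)}\frac{\Gamma(k)}{\Gamma(a)}\tilde\alpha_m$ one has $$\beta_N=\sum_{m=0}^N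 M_{Nm}(a,k)\,\alpha_m .$$ 4. The matrix $M(a,k)$ is triangular: $M_{nm}(a,k)=0$ for $m>n$ (owing to the factor $1/\theta(q)_{n-m}$, read as $\prod_{j=1}^{m-n}\theta(q^{1-j};p)=0$). -/

import Mathlib

open Filter Topology

noncomputable section

namespace EllipticBailey

/-- The infinite `q`-Pochhammer symbol `(z; q)_∞ = ∏_{j ≥ 0} (1 - z q^j)`. -/
def qPochInf (z q : ℂ) : ℂ := ∏' j : ℕ, (1 - z * q ^ j)

/-- The short Jacobi theta function `θ(z; p) = (z; p)_∞ (p / z; p)_∞`. -/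
def theta (z p : ℂ) : ℂ := qPochInf z p * qPochInf (p * z⁻¹) p

/-- The elliptic gamma function
`Γ(z; p, q) = ∏_{j, k ≥ 0} (1 - z⁻¹ p^(j+1) q^(k+1)) / (1 - z p^j q^k)`. -/
def ellGamma (p q z : ℂ) : ℂ :=
  (∏' jk : ℕ × ℕ, (1 - z⁻¹ * p ^ (jk.1 + 1) * q ^ (jk.2 + 1))) /
    ∏' jk : ℕ × ℕ, (1 - z * p ^ jk.1 * q ^ jk.2)

/-- The elliptic Pochhammer symbol `θ(z; p)_n` (with base `q`), for an integer `n`: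
`∏_{j=0}^{n-1} θ(z q^j; p)` if `n ≥ 0`, and `∏_{j=1}^{-n} 1 / θ(z q^{-j}; p)` if `n < 0`. -/
def ellPoch (p q z : ℂ) : ℤ → ℂ
  | Int.ofNat n => ∏ j ∈ Finset.range n, theta (z * q ^ j) p
  | Int.negSucc n => ∏ j ∈ Finset.Icc 1 (n + 1), (theta (z * (q ^ j)⁻¹) p)⁻¹

/-- The elliptic Bressoud-type matrix `M_{Nm}(a, k)`. -/
def baileyMatrix (p q a k : ℂ) (N m : ℕ) : ℂ :=
  (ellPoch p q k ((N : ℤ) + m) * ellPoch p q (k / a) ((N : ℤ) - m)) /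
      (ellPoch p q (q * a) ((N : ℤ) + m) * ellPoch p q q ((N : ℤ) - m)) *
    (theta (a * q ^ (2 * m)) p / theta a p) * a ^ ((N : ℤ) - m)

/-- A closed, piecewise continuously differentiable curve of finite length in the complex plane,
parametrized by `[0, 1]`. -/
structure ClosedCurve where
  toFun : ℝ → ℂ
  continuousOn : ContinuousOn toFun (Set.Icc 0 1)
  closed : toFun 0 = toFun 1
  breaks : Finset ℝ
  differentiableAt : ∀ s ∈ Set.Ioo (0 : ℝ) 1 \ (breaks : Set ℝ), DifferentiableAt ℝ toFun s
  continuousOn_deriv : ContinuousOn (deriv toFun) (Set.Ioo (0 : ℝ) 1 \ (breaks : Set ℝ))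
  integrable_deriv : IntervalIntegrable (deriv toFun) MeasureTheory.volume 0 1

/-- An integration contour: a finite sum of closed curves (a cycle). -/
abbrev Contour := List ClosedCurve

/-- The set of points of the contour. -/
def Contour.support (C : Contour) : Set ℂ := {z | ∃ γ ∈ C, ∃ s ∈ Set.Icc (0 : ℝ) 1, γ.toFun s = z}

/-- The contour integral `∫_C f(z) dz`. -/
def Contour.integral (C : Contour) (f : ℂ → ℂ) : ℂ :=
  (C.map fun γ => ∫ s in (0 : ℝ)..1, f (γ.toFun s) * deriv γ.toFun s).sum

/-- The winding number of the contour about `w` (meaningful for `w` off the contour). -/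
def Contour.winding (C : Contour) (w : ℂ) : ℂ :=
  (2 * Real.pi * Complex.I)⁻¹ * C.integral fun z => (z - w)⁻¹

/-- The contour separates `I` (encircled once, counterclockwise) from `O` (not encircled),
and it passes through no point of either set. -/
def Contour.Separates (C : Contour) (I O : Set ℂ) : Prop :=
  (∀ w ∈ I, w ∉ C.support ∧ C.winding w = 1) ∧ (∀ w ∈ O, w ∉ C.support ∧ C.winding w = 0)

/-- The kernel `Γ(t x^{±1} z^{±1}; p, q) / Γ(t^2, z^{±2}; p, q)` of the elliptic Fourier
transform. -/
def kernel (p q t x z : ℂ) : ℂ :=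
  (ellGamma p q (t * x * z) * ellGamma p q (t * x * z⁻¹) *
      ellGamma p q (t * x⁻¹ * z) * ellGamma p q (t * x⁻¹ * z⁻¹)) /
    (ellGamma p q (t ^ 2) * (ellGamma p q (z ^ 2) * ellGamma p q (z⁻¹ ^ 2)))

/-- The poles `t x^{±1} q^i p^j` of the kernel, which accumulate at the origin. The other poles
of the kernel are their reciprocals. -/
def kernelPoles (p q t x : ℂ) : Set ℂ :=
  {w | ∃ i j : ℕ, w = t * x * q ^ i * p ^ j ∨ w = t * x⁻¹ * q ^ i * p ^ j}

/-- The points `z₀ q^m`, `m = 0, …, N`. -/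
def seqPoles (q z₀ : ℂ) (N : ℕ) : Set ℂ := {w | ∃ m : ℕ, m ≤ N ∧ w = z₀ * q ^ m}

/-- `κ = (p; p)_∞ (q; q)_∞ / (4 π i)`. -/
def kappa (p q : ℂ) : ℂ := qPochInf p p * qPochInf q q / (4 * Real.pi * Complex.I)

/-- `κ ∫_C Γ(t x^{±1} z^{±1}) / Γ(t^2, z^{±2}) α(z) dz / z`. -/
def eftIntegral (p q t x : ℂ) (α : ℂ → ℂ) (C : Contour) : ℂ :=
  kappa p q * C.integral fun z => kernel p q t x z * α z / z

/-- The contours that define the elliptic Fourier transform at `(t, x)` of a function whose poles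
in the punctured plane are at `A` (inside) and at the reciprocals of `A` (outside): the origin, the
kernel poles converging to it, and `A` are encircled; all the reciprocal poles are not. The unit
circle is of this kind if `|t x|, |t / x| < 1` and `A` lies in the open unit disc. -/
def IsDefiningContour (p q t x : ℂ) (A : Set ℂ) (C : Contour) : Prop :=
  C.Separates ({0} ∪ kernelPoles p q t x ∪ A) {w | w⁻¹ ∈ kernelPoles p q t x ∪ A}

/-- The contours obtained from the defining ones by crossing the poles at `A` and at the
reciprocals of `A`, but no pole of the kernel: now the reciprocals of `A` are encircled and `A` is
not. -/
def IsDeformedContour (p q t x : ℂ) (A : Set ℂ) (C : Contour) : Prop :=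
  C.Separates ({0} ∪ kernelPoles p q t x ∪ {w | w⁻¹ ∈ A}) ({w | w⁻¹ ∈ kernelPoles p q t x} ∪ A)

/-- `b` is the value at `x` of the (analytically continued) elliptic Fourier transform
`M(t)_{xz} α(z)`, where `A` is the set of the poles of `α` that count as inner ones. -/
def IsEFT (p q t x : ℂ) (A : Set ℂ) (α : ℂ → ℂ) (b : ℂ) : Prop :=
  ∃ C : Contour, IsDefiningContour p q t x A C ∧ b = eftIntegral p q t x α C

end EllipticBailey

end

/-! Since t x_ε⁻¹ q^(N-m) = ε / (z₀ q^m), an inner pole of the kernel runs into the outer pole 1 /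
(z₀ q^m) of α as ε → 1; by the symmetry z ↦ 1/z the reciprocal points z₀ q^m / ε and z₀ q^m meet as
well. The defining contour is pinched at these N + 1 pairs of points, and this is what can give
β(x_ε) a simple pole at ε = 1.

The pinch is undone by pushing the contour across the poles of α and across no pole of the kernel.
By genericity no kernel pole is the reciprocal of another one at ε = 1, so a deformed contour exists
there; it stays admissible nearby (`IsDeformedContour.eventually`), and its integral stays bounded,
so the factor 1 - ε kills it (`tendsto_one_sub_mul_eftIntegral`). The residues at z₀ q^m and at its
reciprocal are opposite but are crossed in opposite directions, so they add up; hence 4πi κ rather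
than 2πi κ (`eftIntegral_eq_add_residues`).

Only the residue sum survives. In K_t(x_ε, z₀ q^m), with n = N - m, one gamma factor is Γ(ε q^(-n)),
which has a simple pole at ε = 1, while the others stay regular. Stripping all powers of q by Γ(qz)
= θ(z; p) Γ(z) leaves finite theta products that rearrange to M_{Nm}(a, k), and the residue 1 /
((p;p)_∞ (q;q)_∞) cancels 4πi κ (`tendsto_one_sub_mul_kernel`).

As the contours are arbitrary cycles, all this rests on the homology form of Cauchy's theorem
(`Contour.integral_eq_of_winding_eq`), proved by Dixon's argument; the existence of contours comes
from sums of circles (`Contour.exists_separates`). -/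

noncomputable section

namespace EllipticBailey

open Metric MeasureTheory

/-! ### Integrals along one closed curve -/

namespace ClosedCurve

variable (γ : ClosedCurve)

/-- The set of points of a closed curve. -/
def image : Set ℂ := γ.toFun '' Set.Icc 0 1

theorem isCompact_image : IsCompact γ.image :=
  isCompact_Icc.image_of_continuousOn γ.continuousOn

theorem mem_image_of_mem_uIoc {s : ℝ} (hs : s ∈ Set.uIoc (0 : ℝ) 1) : γ.toFun s ∈ γ.image := by
  rw [Set.uIoc_of_le zero_le_one] at hs
  exact Set.mem_image_of_mem _ (Set.Ioc_subset_Icc_self hs)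

theorem intervalIntegrable_mul_deriv {f : ℂ → ℂ} (hf : ContinuousOn f γ.image) :
    IntervalIntegrable (fun s => f (γ.toFun s) * deriv γ.toFun s) volume 0 1 := by
  have h : ContinuousOn (fun s => f (γ.toFun s)) (Set.uIcc 0 1) := by
    rw [Set.uIcc_of_le zero_le_one]
    exact hf.comp γ.continuousOn (Set.mapsTo_image _ _)
  exact γ.integrable_deriv.continuousOn_mul h

/-- The integral of a derivative along a closed curve vanishes. -/
theorem integral_eq_zero_of_hasDerivAt {F F' : ℂ → ℂ}
    (hF : ∀ z ∈ γ.image, HasDerivAt F (F' z) z) (hF' : ContinuousOn F' γ.image) :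
    ∫ s in (0 : ℝ)..1, F' (γ.toFun s) * deriv γ.toFun s = 0 := by
  rw [integral_eq_of_hasDerivAt_off_countable_of_le (fun s => F (γ.toFun s)) _ zero_le_one
    γ.breaks.countable_toSet _ _ (γ.intervalIntegrable_mul_deriv hF')]
  · simp [γ.closed]
  · refine ContinuousOn.comp (t := γ.image) (fun z hz => ?_) γ.continuousOn (Set.mapsTo_image _ _)
    exact (hF z hz).continuousAt.continuousWithinAt
  · intro s hs
    exact (hF _ (Set.mem_image_of_mem _ (Set.Ioo_subset_Icc_self hs.1))).comp s
      (γ.differentiableAt s hs).hasDerivAt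

/-- Differentiation under the integral sign along a curve, for an integrand that depends
holomorphically on the parameter. -/
theorem hasDerivAt_integral {F : ℂ → ℂ → ℂ} {z₀ : ℂ} {r M : ℝ} (hr : 0 < r)
    (hcont : ∀ z ∈ ball z₀ r, ContinuousOn (F z) γ.image)
    (hdiff : ∀ w ∈ γ.image, DifferentiableOn ℂ (fun z => F z w) (ball z₀ r))
    (hbd : ∀ z ∈ ball z₀ r, ∀ w ∈ γ.image, ‖F z w‖ ≤ M) :
    HasDerivAt (fun z => ∫ s in (0 : ℝ)..1, F z (γ.toFun s) * deriv γ.toFun s)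
      (∫ s in (0 : ℝ)..1, deriv (fun z => F z (γ.toFun s)) z₀ * deriv γ.toFun s) z₀ := by
  have hz₀ : z₀ ∈ ball z₀ r := mem_ball_self hr
  have hmeas : ∀ z ∈ ball z₀ r, AEStronglyMeasurable
      (fun s => F z (γ.toFun s) * deriv γ.toFun s) (volume.restrict (Set.uIoc 0 1)) := fun z hz =>
    (γ.intervalIntegrable_mul_deriv (hcont z hz)).def'.aestronglyMeasurable
  have hd : ∀ s ∈ Set.uIoc (0 : ℝ) 1, ∀ z ∈ ball z₀ r,
      HasDerivAt (fun z => F z (γ.toFun s) * deriv γ.toFun s)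
        (deriv (fun z => F z (γ.toFun s)) z * deriv γ.toFun s) z := fun s hs z hz =>
    (((hdiff _ (γ.mem_image_of_mem_uIoc hs)).differentiableAt
      (isOpen_ball.mem_nhds hz)).hasDerivAt).mul_const _
  refine (intervalIntegral.hasDerivAt_integral_of_dominated_loc_of_deriv_le
    (F' := fun z s => deriv (fun z => F z (γ.toFun s)) z * deriv γ.toFun s)
    (bound := fun s => M / (r / 2) * ‖deriv γ.toFun s‖)
    (ball_mem_nhds z₀ (half_pos hr)) ?_ (γ.intervalIntegrable_mul_deriv (hcont z₀ hz₀)) ?_ ?_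
    (γ.integrable_deriv.norm.const_mul _) ?_).2
  · filter_upwards [ball_mem_nhds z₀ hr] with z hz using hmeas z hz
  -- The derivative in the parameter is measurable along the curve as a limit of difference
  -- quotients. The steps r / (n + 2) are nonzero and at most r / 2, so the shifted points stay in
  -- the open ball already for n = 0.
  · have hstep : Tendsto (fun n : ℕ => ((r / (n + 2) : ℝ) : ℂ)) atTop (𝓝[≠] 0) := by
      refine tendsto_nhdsWithin_iff.2 ⟨?_, Eventually.of_forall fun n => ?_⟩
      · have h : Tendsto (fun n : ℕ => r / ((n : ℝ) + 2)) atTop (𝓝 0) :=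
          tendsto_const_nhds.div_atTop
            (tendsto_atTop_add_const_right _ _ tendsto_natCast_atTop_atTop)
        exact_mod_cast (Complex.continuous_ofReal.tendsto 0).comp h
      · have : r / ((n : ℝ) + 2) ≠ 0 := by positivity
        simpa only [Set.mem_compl_iff, Set.mem_singleton_iff, Complex.ofReal_eq_zero] using this
    have hin : ∀ n : ℕ, z₀ + ((r / (n + 2) : ℝ) : ℂ) ∈ ball z₀ r := fun n => by
      have : (0 : ℝ) < n + 2 := by positivity
      rw [mem_ball, dist_eq_norm, add_sub_cancel_left, Complex.norm_real, Real.norm_eq_abs,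
        abs_of_pos (by positivity), div_lt_iff₀ this]
      nlinarith [(Nat.cast_nonneg n : (0 : ℝ) ≤ n)]
    refine aestronglyMeasurable_of_tendsto_ae atTop (f := fun n s =>
      ((r / ((n : ℕ) + 2) : ℝ) : ℂ)⁻¹ • (F (z₀ + ((r / (n + 2) : ℝ) : ℂ)) (γ.toFun s) *
        deriv γ.toFun s - F z₀ (γ.toFun s) * deriv γ.toFun s))
      (fun n => ((hmeas _ (hin n)).sub (hmeas _ hz₀)).const_smul
        ((r / ((n : ℕ) + 2) : ℝ) : ℂ)⁻¹) ?_
    refine (ae_restrict_iff' measurableSet_uIoc).2 (Eventually.of_forall fun s hs => ?_)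
    exact (hd s hs z₀ hz₀).tendsto_slope_zero.comp hstep
  · refine Eventually.of_forall fun s hs z hz => ?_
    rw [norm_mul]
    refine mul_le_mul_of_nonneg_right ?_ (norm_nonneg _)
    -- Cauchy's estimate on the circle of radius r / 2 about z gives the dominating constant M / (r
    -- / 2).
    have hsub : closedBall z (r / 2) ⊆ ball z₀ r := fun u hu => by
      rw [mem_closedBall] at hu
      rw [mem_ball] at hz ⊢
      linarith [dist_triangle u z z₀]
    refine Complex.norm_deriv_le_of_forall_mem_sphere_norm_le (half_pos hr) ?_
      fun u hu => hbd u (hsub (sphere_subset_closedBall hu)) _ (γ.mem_image_of_mem_uIoc hs)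
    exact ((hdiff _ (γ.mem_image_of_mem_uIoc hs)).mono
      ((closure_ball_subset_closedBall).trans hsub)).diffContOnCl
  · refine Eventually.of_forall fun s hs z hz => hd s hs z (ball_subset_ball (by linarith) hz)

/-- Changing the integrand at countably many points does not change an integral along a curve. -/
theorem integral_congr_of_countable {f g : ℂ → ℂ} {D : Set ℂ} (hD : D.Countable)
    (h : ∀ z ∈ γ.image, z ∉ D → f z = g z) :
    ∫ s in (0 : ℝ)..1, f (γ.toFun s) * deriv γ.toFun s =
      ∫ s in (0 : ℝ)..1, g (γ.toFun s) * deriv γ.toFun s := by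
  -- Times at which the curve sits at w with nonzero velocity are isolated, hence countable in
  -- number. Where the velocity vanishes, the value of the integrand does not matter.
  have hcount : (⋃ w ∈ D, {s | γ.toFun s = w ∧ deriv γ.toFun s ≠ 0}).Countable := by
    refine hD.biUnion fun w _ => ?_
    refine Set.Countable.mono (fun s hs => ?_) (countable_setOfPred_isolated_right_within
      (s := {s | γ.toFun s = w ∧ deriv γ.toFun s ≠ 0}))
    have hne := (differentiableAt_of_deriv_ne_zero hs.2).hasDerivAt.eventually_ne (c := w) hs.2
    refine ⟨hs, eventually_false_iff_eq_bot.1 ?_⟩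
    filter_upwards [hne.filter_mono (nhdsWithin_mono _ fun u hu => ne_of_gt hu.2),
      self_mem_nhdsWithin] with u hu hu'
    exact hu hu'.1.1
  refine intervalIntegral.integral_congr_ae ?_
  filter_upwards [hcount.ae_notMem volume] with s hs hs'
  by_cases hsD : γ.toFun s ∈ D
  · have : deriv γ.toFun s = 0 := by
      by_contra hne
      exact hs (Set.mem_biUnion hsD ⟨rfl, hne⟩)
    simp [this]
  · rw [h _ (γ.mem_image_of_mem_uIoc hs') hsD]

end ClosedCurve

/-! ### Integrals along cycles -/

namespace Contour

@[simp] theorem integral_nil (f : ℂ → ℂ) : Contour.integral [] f = 0 := by simp [Contour.integral]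

theorem integral_cons (γ : ClosedCurve) (C : Contour) (f : ℂ → ℂ) :
    Contour.integral (γ :: C) f =
      (∫ s in (0 : ℝ)..1, f (γ.toFun s) * deriv γ.toFun s) + C.integral f := by
  simp [Contour.integral]

theorem integral_append (C C' : Contour) (f : ℂ → ℂ) :
    Contour.integral (C ++ C') f = C.integral f + C'.integral f := by
  simp [Contour.integral]

theorem winding_append (C C' : Contour) (w : ℂ) :
    Contour.winding (C ++ C') w = C.winding w + C'.winding w := by
  simp [Contour.winding, integral_append, mul_add]

@[simp] theorem support_nil : Contour.support [] = ∅ := by simp [Contour.support]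

theorem support_cons (γ : ClosedCurve) (C : Contour) :
    Contour.support (γ :: C) = γ.image ∪ C.support := by
  ext z
  simp [Contour.support, ClosedCurve.image]

theorem support_append (C C' : Contour) :
    Contour.support (C ++ C') = C.support ∪ C'.support := by
  induction C with
  | nil => simp
  | cons γ C ih => rw [List.cons_append, support_cons, support_cons, ih, Set.union_assoc]

theorem isCompact_support (C : Contour) : IsCompact C.support := by
  induction C with
  | nil => simp
  | cons γ C ih => rw [support_cons]; exact γ.isCompact_image.union ih

theorem integral_sub (C : Contour) {f g : ℂ → ℂ} (hf : ContinuousOn f C.support)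
    (hg : ContinuousOn g C.support) :
    C.integral (fun z => f z - g z) = C.integral f - C.integral g := by
  induction C with
  | nil => simp
  | cons γ C ih =>
    rw [support_cons] at hf hg
    simp only [integral_cons, sub_mul]
    rw [intervalIntegral.integral_sub
      (γ.intervalIntegrable_mul_deriv (hf.mono Set.subset_union_left))
      (γ.intervalIntegrable_mul_deriv (hg.mono Set.subset_union_left)),
      ih (hf.mono Set.subset_union_right) (hg.mono Set.subset_union_right)]
    ring

theorem integral_const_mul (C : Contour) (c : ℂ) (f : ℂ → ℂ) :
    C.integral (fun z => c * f z) = c * C.integral f := by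
  induction C with
  | nil => simp
  | cons γ C ih =>
    simp only [integral_cons, mul_assoc, intervalIntegral.integral_const_mul, ih, mul_add]

theorem integral_congr_of_countable (C : Contour) {f g : ℂ → ℂ} {D : Set ℂ} (hD : D.Countable)
    (h : ∀ z ∈ C.support, z ∉ D → f z = g z) : C.integral f = C.integral g := by
  induction C with
  | nil => simp
  | cons γ C ih =>
    rw [support_cons] at h
    rw [integral_cons, integral_cons, ih fun z hz => h z (Or.inr hz),
      γ.integral_congr_of_countable hD fun z hz => h z (Or.inl hz)]

theorem integral_congr (C : Contour) {f g : ℂ → ℂ} (h : ∀ z ∈ C.support, f z = g z) :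
    C.integral f = C.integral g :=
  C.integral_congr_of_countable Set.countable_empty fun z hz _ => h z hz

theorem integral_eq_zero_of_hasDerivAt (C : Contour) {F F' : ℂ → ℂ}
    (hF : ∀ z ∈ C.support, HasDerivAt F (F' z) z) (hF' : ContinuousOn F' C.support) :
    C.integral F' = 0 := by
  induction C with
  | nil => simp
  | cons γ C ih =>
    rw [support_cons] at hF hF'
    rw [integral_cons, ih (fun z hz => hF z (Or.inr hz)) (hF'.mono Set.subset_union_right),
      γ.integral_eq_zero_of_hasDerivAt (fun z hz => hF z (Or.inl hz))
        (hF'.mono Set.subset_union_left), add_zero]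

theorem hasDerivAt_integral (C : Contour) {F : ℂ → ℂ → ℂ} {z₀ : ℂ} {r M : ℝ} (hr : 0 < r)
    (hcont : ∀ z ∈ ball z₀ r, ContinuousOn (F z) C.support)
    (hdiff : ∀ w ∈ C.support, DifferentiableOn ℂ (fun z => F z w) (ball z₀ r))
    (hbd : ∀ z ∈ ball z₀ r, ∀ w ∈ C.support, ‖F z w‖ ≤ M) :
    HasDerivAt (fun z => C.integral (F z))
      (C.integral fun w => deriv (fun z => F z w) z₀) z₀ := by
  induction C with
  | nil => simpa using hasDerivAt_const z₀ (0 : ℂ)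
  | cons γ C ih =>
    rw [support_cons] at hcont hdiff hbd
    simp only [integral_cons]
    exact (γ.hasDerivAt_integral hr (fun z hz => (hcont z hz).mono Set.subset_union_left)
      (fun w hw => hdiff w (Or.inl hw)) (fun z hz w hw => hbd z hz w (Or.inl hw))).add
      (ih (fun z hz => (hcont z hz).mono Set.subset_union_right)
        (fun w hw => hdiff w (Or.inr hw)) (fun z hz w hw => hbd z hz w (Or.inr hw)))

/-- A bound for a contour integral in terms of the supremum of the integrand on the contour. -/
theorem exists_norm_integral_le (C : Contour) :
    ∃ L : ℝ, 0 ≤ L ∧ ∀ (f : ℂ → ℂ) (M : ℝ), 0 ≤ M → (∀ z ∈ C.support, ‖f z‖ ≤ M) →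
      ‖C.integral f‖ ≤ M * L := by
  induction C with
  | nil => exact ⟨0, le_rfl, fun f M _ _ => by simp⟩
  | cons γ C ih =>
    obtain ⟨L, hL, h⟩ := ih
    refine ⟨(∫ s in (0 : ℝ)..1, ‖deriv γ.toFun s‖) + L, add_nonneg
      (intervalIntegral.integral_nonneg zero_le_one fun _ _ => norm_nonneg _) hL,
      fun f M hM hf => ?_⟩
    rw [support_cons] at hf
    rw [integral_cons, mul_add]
    refine (norm_add_le _ _).trans (add_le_add ?_ (h f M hM fun z hz => hf z (Or.inr hz)))
    rw [← intervalIntegral.integral_const_mul]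
    refine intervalIntegral.norm_integral_le_of_norm_le zero_le_one
      (Eventually.of_forall fun s hs => ?_) (γ.integrable_deriv.norm.const_mul M)
    rw [norm_mul]
    exact mul_le_mul_of_nonneg_right
      (hf _ (Or.inl (Set.mem_image_of_mem _ (Set.Ioc_subset_Icc_self hs)))) (norm_nonneg _)

end Contour

end EllipticBailey

end

/-! ### Winding numbers and the homology form of Cauchy's theorem -/

noncomputable section

namespace EllipticBailey

open Metric MeasureTheory

namespace Contour

theorem continuousOn_inv_sub {K : Set ℂ} {w : ℂ} (hw : w ∉ K) :
    ContinuousOn (fun z => (z - w)⁻¹) K :=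
  ContinuousOn.inv₀ (by fun_prop) fun z hz h => hw ((sub_eq_zero.1 h : z = w) ▸ hz)

theorem integral_inv_sub (C : Contour) (w : ℂ) :
    C.integral (fun z => (z - w)⁻¹) = 2 * Real.pi * Complex.I * C.winding w := by
  have : (2 * Real.pi * Complex.I : ℂ) ≠ 0 := Complex.two_pi_I_ne_zero
  rw [Contour.winding, mul_inv_cancel_left₀ this]

/-- The Cauchy transform of a continuous function on a contour is holomorphic off the contour. -/
theorem hasDerivAt_integral_div (C : Contour) {f : ℂ → ℂ} (hf : ContinuousOn f C.support)
    {z₀ : ℂ} (hz₀ : z₀ ∉ C.support) :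
    HasDerivAt (fun z => C.integral fun w => f w * (w - z)⁻¹)
      (C.integral fun w => f w * ((w - z₀) ^ 2)⁻¹) z₀ := by
  obtain ⟨r, hr, hsub⟩ := Metric.isOpen_iff.1 C.isCompact_support.isClosed.isOpen_compl z₀ hz₀
  obtain ⟨B, hB⟩ := C.isCompact_support.exists_bound_of_continuousOn hf
  have hne : ∀ z ∈ ball z₀ (r / 2), ∀ w ∈ C.support, w - z ≠ 0 := fun z hz w hw h =>
    hsub (ball_subset_ball (by linarith) hz) (sub_eq_zero.1 h ▸ hw)
  have hd : ∀ z ∈ ball z₀ (r / 2), ∀ w ∈ C.support,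
      HasDerivAt (fun z => f w * (w - z)⁻¹) (f w * ((w - z) ^ 2)⁻¹) z := fun z hz w hw => by
    have h := (((hasDerivAt_id z).const_sub w).inv (hne z hz w hw)).const_mul (f w)
    simpa [div_eq_mul_inv] using h
  have key := C.hasDerivAt_integral (F := fun z w => f w * (w - z)⁻¹) (z₀ := z₀)
    (M := B * (r / 2)⁻¹) (half_pos hr)
    (fun z hz => hf.mul (continuousOn_inv_sub fun h =>
      hsub (ball_subset_ball (by linarith) hz) h))
    (fun w hw z hz => (hd z hz w hw).differentiableAt.differentiableWithinAt) ?_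
  · have heq : C.integral (fun w => deriv (fun z => f w * (w - z)⁻¹) z₀) =
        C.integral (fun w => f w * ((w - z₀) ^ 2)⁻¹) :=
      C.integral_congr fun w hw => (hd z₀ (mem_ball_self (half_pos hr)) w hw).deriv
    rwa [heq] at key
  · intro z hz w hw
    rw [norm_mul, norm_inv]
    have h1 : r ≤ dist w z₀ := by
      by_contra h
      exact hsub (mem_ball.2 (not_le.1 h)) hw
    have h2 : r / 2 ≤ ‖w - z‖ := by
      rw [← dist_eq_norm]
      rw [mem_ball] at hz
      linarith [dist_triangle w z z₀]
    exact mul_le_mul (hB w hw) (inv_anti₀ (half_pos hr) h2) (by positivity)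
      ((norm_nonneg _).trans (hB w hw))

/-- Differentiating under the integral sign gives the integrand (w - z₀)⁻², which has the primitive
-(w - z₀)⁻¹ and so integrates to zero along closed curves. -/
theorem hasDerivAt_winding (C : Contour) {z₀ : ℂ} (hz₀ : z₀ ∉ C.support) :
    HasDerivAt C.winding 0 z₀ := by
  have h := (C.hasDerivAt_integral_div (f := fun _ => 1) continuousOn_const hz₀).const_mul
    (2 * Real.pi * Complex.I : ℂ)⁻¹
  have h0 : C.integral (fun w => 1 * ((w - z₀) ^ 2)⁻¹) = 0 := by
    have hne : ∀ z ∈ C.support, z - z₀ ≠ 0 := fun z hz h => hz₀ (sub_eq_zero.1 h ▸ hz)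
    refine C.integral_eq_zero_of_hasDerivAt (F := fun w => -(w - z₀)⁻¹) (fun z hz => ?_) ?_
    · have h1 : HasDerivAt (fun w => -(w - z₀)⁻¹) _ z :=
        (((hasDerivAt_id z).sub_const z₀).inv (hne z hz)).neg
      simpa [div_eq_mul_inv] using h1
    · exact continuousOn_const.mul
        (((continuousOn_id.sub continuousOn_const).pow 2).inv₀ fun z hz => pow_ne_zero 2 (hne z hz))
  rw [h0, mul_zero] at h
  have heq : C.winding = fun z => (2 * Real.pi * Complex.I : ℂ)⁻¹ *
      C.integral fun w => 1 * (w - z)⁻¹ := by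
    funext z
    simp only [Contour.winding, one_mul]
  rwa [heq]

/-- The winding number is locally constant off the contour. -/
theorem exists_ball_winding_eq (C : Contour) {z₀ : ℂ} (hz₀ : z₀ ∉ C.support) :
    ∃ r > 0, ∀ z ∈ ball z₀ r, z ∉ C.support ∧ C.winding z = C.winding z₀ := by
  obtain ⟨r, hr, hsub⟩ := Metric.isOpen_iff.1 C.isCompact_support.isClosed.isOpen_compl z₀ hz₀
  refine ⟨r, hr, fun z hz => ⟨hsub hz, ?_⟩⟩
  exact isOpen_ball.is_const_of_deriv_eq_zero (convex_ball z₀ r).isPreconnected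
    (fun w hw => (C.hasDerivAt_winding (hsub hw)).differentiableAt.differentiableWithinAt)
    (fun w hw => (C.hasDerivAt_winding (hsub hw)).deriv) hz (mem_ball_self hr)

theorem isOpen_setOf_winding_eq (C : Contour) (c : ℂ) :
    IsOpen {z | z ∉ C.support ∧ C.winding z = c} := by
  refine Metric.isOpen_iff.2 fun z hz => ?_
  obtain ⟨r, hr, h⟩ := C.exists_ball_winding_eq hz.1
  exact ⟨r, hr, fun w hw => ⟨(h w hw).1, (h w hw).2.trans hz.2⟩⟩

/-- The winding number vanishes outside a disc that contains the contour. -/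
theorem winding_eq_zero_of_norm_lt (C : Contour) {R : ℝ} (hR : C.support ⊆ closedBall 0 R) {z : ℂ}
    (hz : R < ‖z‖) : z ∉ C.support ∧ C.winding z = 0 := by
  have hzs : z ∉ C.support := fun h => by
    have := hR h
    rw [mem_closedBall, dist_zero_right] at this
    linarith
  refine ⟨hzs, ?_⟩
  rcases C.support.eq_empty_or_nonempty with he | ⟨w₀, hw₀⟩
  · rw [Contour.winding, C.integral_congr (g := fun z => 0 * z) (by simp [he]),
      integral_const_mul]
    simp
  have hR0 : 0 ≤ R := by
    have := hR hw₀
    rw [mem_closedBall, dist_zero_right] at this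
    exact (norm_nonneg _).trans this
  have hz0 : z ≠ 0 := norm_pos_iff.1 (hR0.trans_lt hz)
  -- For |w| ≤ R < |z| the point 1 - w / z stays in the slit plane, so log(1 - w / z) is a global
  -- primitive of 1 / (w - z) along the contour.
  rw [Contour.winding, C.integral_eq_zero_of_hasDerivAt (F := fun w => Complex.log (1 - w / z))
    (fun w hw => ?_) (continuousOn_inv_sub hzs), mul_zero]
  have hlt : ‖w / z‖ < 1 := by
    have := hR hw
    rw [mem_closedBall, dist_zero_right] at this
    rw [norm_div, div_lt_one (norm_pos_iff.2 hz0)]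
    exact this.trans_lt hz
  have hslit : 1 - w / z ∈ Complex.slitPlane := by
    rw [sub_eq_add_neg]
    exact Complex.mem_slitPlane_of_norm_lt_one (by simpa using hlt)
  have h : HasDerivAt (fun w => Complex.log (1 - w / z)) (-(1 / z) / (1 - w / z)) w :=
    (((hasDerivAt_id w).div_const z).const_sub 1).clog hslit
  have hwz : w - z ≠ 0 := fun h => hzs (sub_eq_zero.1 h ▸ hw)
  have hzw : z - w ≠ 0 := fun h => hwz (by linear_combination -h)
  convert h using 1
  field_simp
  ring

/-- This symmetry turns holomorphy of the difference quotient in one variable into holomorphy in the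
other. -/
theorem dslope_comm (f : ℂ → ℂ) (z w : ℂ) : dslope f z w = dslope f w z := by
  rcases eq_or_ne z w with rfl | h
  · rfl
  · rw [dslope_of_ne _ h, dslope_of_ne _ h.symm, slope_comm]

/-- Near the diagonal the mean value inequality on a disc bounds the quotient by the supremum of
|f'|; away from it the denominator is bounded below. The uniform bound is what differentiation under
the integral sign requires. -/
theorem exists_bound_dslope {f : ℂ → ℂ} {U K : Set ℂ} (hU : IsOpen U)
    (hf : DifferentiableOn ℂ f U) (hK : IsCompact K) (hKU : K ⊆ U) {z₀ : ℂ} (hz₀ : z₀ ∈ U) :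
    ∃ r > 0, ball z₀ r ⊆ U ∧ ∃ M, ∀ z ∈ ball z₀ r, ∀ w ∈ K, ‖dslope f z w‖ ≤ M := by
  obtain ⟨ρ, hρ, hsub⟩ := Metric.isOpen_iff.1 hU z₀ hz₀
  have hcb : closedBall z₀ (ρ / 2) ⊆ U := (closedBall_subset_ball (by linarith)).trans hsub
  obtain ⟨B, hB⟩ := (isCompact_closedBall z₀ (ρ / 2)).exists_bound_of_continuousOn
    ((hf.deriv hU).continuousOn.mono hcb)
  obtain ⟨B', hB'⟩ := ((isCompact_closedBall z₀ (ρ / 2)).union hK).exists_bound_of_continuousOn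
    (hf.continuousOn.mono (Set.union_subset hcb hKU))
  have hB0 : 0 ≤ B := (norm_nonneg _).trans (hB z₀ (mem_closedBall_self (by linarith)))
  refine ⟨ρ / 4, by linarith, (ball_subset_ball (by linarith)).trans hsub,
    max B ((B' + B') / (ρ / 4)), fun z hz w hw => ?_⟩
  have hz2 : z ∈ closedBall z₀ (ρ / 2) :=
    (ball_subset_closedBall.trans (closedBall_subset_closedBall (by linarith))) hz
  rcases eq_or_ne w z with rfl | hwz
  · rw [dslope_same]
    exact (hB w hz2).trans (le_max_left _ _)
  rw [dslope_of_ne _ hwz, slope_def_field, norm_div]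
  have hpos : 0 < ‖w - z‖ := norm_pos_iff.2 (sub_ne_zero.2 hwz)
  by_cases hw2 : w ∈ closedBall z₀ (ρ / 2)
  · refine le_trans ?_ (le_max_left _ _)
    rw [div_le_iff₀ hpos]
    exact (convex_closedBall z₀ (ρ / 2)).norm_image_sub_le_of_norm_deriv_le
      (fun u hu => (hf u (hcb hu)).differentiableAt (hU.mem_nhds (hcb hu))) hB hz2 hw2
  · refine le_trans ?_ (le_max_right _ _)
    have h1 : ρ / 4 ≤ ‖w - z‖ := by
      rw [mem_closedBall, not_le] at hw2
      rw [mem_ball] at hz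
      rw [← dist_eq_norm]
      linarith [dist_triangle w z z₀]
    exact div_le_div₀ (by linarith [norm_nonneg (f z), hB' z (Or.inl hz2)])
      ((norm_sub_le _ _).trans (add_le_add (hB' w (Or.inr hw)) (hB' z (Or.inl hz2))))
      (by linarith) h1

theorem differentiableAt_integral_dslope (C : Contour) {f : ℂ → ℂ} {U : Set ℂ} (hU : IsOpen U)
    (hf : DifferentiableOn ℂ f U) (hC : C.support ⊆ U) {z₀ : ℂ} (hz₀ : z₀ ∈ U) :
    DifferentiableAt ℂ (fun z => C.integral (dslope f z)) z₀ := by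
  obtain ⟨r, hr, hsub, M, hM⟩ := exists_bound_dslope hU hf C.isCompact_support hC hz₀
  refine (C.hasDerivAt_integral hr (fun z hz => ?_) (fun w hw => ?_) hM).differentiableAt
  · exact ((Complex.differentiableOn_dslope (hU.mem_nhds (hsub hz))).2 hf).continuousOn.mono hC
  · simp_rw [fun z => dslope_comm f z w]
    exact ((Complex.differentiableOn_dslope (hU.mem_nhds (hC hw))).2 hf).mono hsub

/-- The homology form of Cauchy's theorem: the integrals of a holomorphic function along two
contours with the same winding numbers about all points outside its domain agree. -/
theorem integral_eq_of_winding_eq (C C' : Contour) {f : ℂ → ℂ} {U : Set ℂ} (hU : IsOpen U)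
    (hf : DifferentiableOn ℂ f U) (hC : C.support ⊆ U) (hC' : C'.support ⊆ U)
    (hw : ∀ z ∉ U, C.winding z = C'.winding z) : C.integral f = C'.integral f := by
  obtain ⟨R, hR⟩ := (C.isCompact_support.union C'.isCompact_support).isBounded.subset_closedBall 0
  have hRC : C.support ⊆ closedBall 0 R := Set.subset_union_left.trans hR
  have hRC' : C'.support ⊆ closedBall 0 R := Set.subset_union_right.trans hR
  -- It suffices to compare Cauchy transforms at one far point z: applied to g(w) = f(w) (w - z),
  -- they are the integrals of f itself.
  suffices H : ∀ g : ℂ → ℂ, DifferentiableOn ℂ g U → ∀ z, R < ‖z‖ →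
      C.integral (fun w => g w * (w - z)⁻¹) = C'.integral (fun w => g w * (w - z)⁻¹) by
    obtain ⟨z, hz⟩ : ∃ z : ℂ, R < ‖z‖ := by
      obtain ⟨x, hx⟩ := exists_gt (max R 0)
      refine ⟨x, ?_⟩
      rw [Complex.norm_real, Real.norm_eq_abs, abs_of_pos ((le_max_right _ _).trans_lt hx)]
      exact (le_max_left _ _).trans_lt hx
    have h := H (fun w => f w * (w - z)) (hf.mul (differentiableOn_id.sub_const z)) z hz
    rwa [C.integral_congr (g := f) fun w hw => ?_, C'.integral_congr (g := f) fun w hw => ?_] at h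
    · have : w - z ≠ 0 := fun h0 =>
        (C'.winding_eq_zero_of_norm_lt hRC' hz).1 (sub_eq_zero.1 h0 ▸ hw)
      rw [mul_assoc, mul_inv_cancel₀ this, mul_one]
    · have : w - z ≠ 0 := fun h0 =>
        (C.winding_eq_zero_of_norm_lt hRC hz).1 (sub_eq_zero.1 h0 ▸ hw)
      rw [mul_assoc, mul_inv_cancel₀ this, mul_one]
  intro f hf
  classical
  -- On the open set V both winding numbers agree, so the terms f(z) · 2πi · winding that
  -- distinguish the integrals of the difference quotient from the Cauchy transforms cancel in the
  -- difference.
  let V : Set ℂ := {z | z ∉ C.support ∧ z ∉ C'.support ∧ C.winding z = C'.winding z}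
  have hV : IsOpen V := by
    refine Metric.isOpen_iff.2 fun z hz => ?_
    obtain ⟨r, hr, h⟩ := C.exists_ball_winding_eq hz.1
    obtain ⟨r', hr', h'⟩ := C'.exists_ball_winding_eq hz.2.1
    refine ⟨min r r', lt_min hr hr', fun w hw => ?_⟩
    have h1 := h w (ball_subset_ball (min_le_left _ _) hw)
    have h2 := h' w (ball_subset_ball (min_le_right _ _) hw)
    exact ⟨h1.1, h2.1, by rw [h1.2, h2.2, hz.2.2]⟩
  have hUV : ∀ z, z ∉ U → z ∈ V := fun z hz =>
    ⟨fun h => hz (hC h), fun h => hz (hC' h), hw z hz⟩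
  have hRV : ∀ z, R < ‖z‖ → z ∈ V := fun z hz =>
    ⟨(C.winding_eq_zero_of_norm_lt hRC hz).1, (C'.winding_eq_zero_of_norm_lt hRC' hz).1,
      (C.winding_eq_zero_of_norm_lt hRC hz).2.trans
        (C'.winding_eq_zero_of_norm_lt hRC' hz).2.symm⟩
  let T : ℂ → ℂ := fun z => C.integral (fun w => f w * (w - z)⁻¹) -
    C'.integral (fun w => f w * (w - z)⁻¹)
  -- Dixon's function: difference quotients on U and Cauchy transforms off U. The two formulas agree
  -- on U ∩ V, and U ∪ V is the whole plane, so h is entire.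
  let h : ℂ → ℂ := fun z => if z ∈ U then C.integral (dslope f z) - C'.integral (dslope f z)
    else T z
  have hT : ∀ z ∈ V, h z = T z := by
    intro z hz
    by_cases hzU : z ∈ U
    · have key : ∀ D : Contour, D.support ⊆ U → z ∉ D.support →
          D.integral (dslope f z) = D.integral (fun w => f w * (w - z)⁻¹) -
            f z * (2 * Real.pi * Complex.I * D.winding z) := by
        intro D hD hzD
        rw [← integral_inv_sub, ← integral_const_mul, ← integral_sub]
        · refine D.integral_congr fun w hw => ?_
          have : w ≠ z := fun h => hzD (h ▸ hw)
          rw [dslope_of_ne _ this, slope_def_field]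
          ring
        · exact (hf.continuousOn.mono hD).mul (continuousOn_inv_sub hzD)
        · exact continuousOn_const.mul (continuousOn_inv_sub hzD)
      simp only [h, T, if_pos hzU]
      rw [key C hC hz.1, key C' hC' hz.2.1, hz.2.2]
      ring
    · simp only [h, if_neg hzU]
  have hdiff : Differentiable ℂ h := by
    intro z
    by_cases hzU : z ∈ U
    · refine ((C.differentiableAt_integral_dslope hU hf hC hzU).sub
        (C'.differentiableAt_integral_dslope hU hf hC' hzU)).congr_of_eventuallyEq ?_
      filter_upwards [hU.mem_nhds hzU] with w hw
      simp only [h, if_pos hw, Pi.sub_apply]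
    · have hzV := hUV z hzU
      refine ((C.hasDerivAt_integral_div (hf.continuousOn.mono hC) hzV.1).sub
        (C'.hasDerivAt_integral_div (hf.continuousOn.mono hC')
          hzV.2.1)).differentiableAt.congr_of_eventuallyEq ?_
      filter_upwards [hV.mem_nhds hzV] with w hw
      exact hT w hw
  have hlim : Tendsto h (cocompact ℂ) (𝓝 0) := by
    have hev : ∀ᶠ z : ℂ in cocompact ℂ, R < ‖z‖ :=
      tendsto_norm_cocompact_atTop.eventually_gt_atTop R
    have key : ∀ D : Contour, D.support ⊆ closedBall 0 R → D.support ⊆ U →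
        Tendsto (fun z => D.integral (fun w => f w * (w - z)⁻¹)) (cocompact ℂ) (𝓝 0) := by
      intro D hDR hD
      obtain ⟨B, hB⟩ := D.isCompact_support.exists_bound_of_continuousOn
        (hf.continuousOn.mono hD)
      obtain ⟨L, hL, hD'⟩ := D.exists_norm_integral_le
      refine squeeze_zero_norm' (a := fun z : ℂ => |B| * (‖z‖ - R)⁻¹ * L) ?_ ?_
      · filter_upwards [hev] with z hz
        have hpos : 0 < ‖z‖ - R := sub_pos.2 hz
        refine hD' _ _ (by positivity) fun w hw => ?_
        rw [norm_mul, norm_inv]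
        have h1 : ‖z‖ - R ≤ ‖w - z‖ := by
          have := hDR hw
          rw [mem_closedBall, dist_zero_right] at this
          rw [norm_sub_rev]
          linarith [norm_sub_norm_le z w]
        exact mul_le_mul ((hB w hw).trans (le_abs_self B)) (inv_anti₀ hpos h1) (by positivity)
          (abs_nonneg _)
      · have : Tendsto (fun z : ℂ => (‖z‖ - R)⁻¹) (cocompact ℂ) (𝓝 0) :=
          tendsto_inv_atTop_zero.comp
            (tendsto_atTop_add_const_right _ _ tendsto_norm_cocompact_atTop)
        simpa using (this.const_mul |B|).mul_const L
    have := (key C hRC hC).sub (key C' hRC' hC')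
    rw [sub_zero] at this
    refine this.congr' ?_
    filter_upwards [hev] with z hz
    exact (hT z (hRV z hz)).symm
  intro z hz
  -- Liouville: an entire function that vanishes at infinity is zero.
  have h0 := hdiff.apply_eq_of_tendsto_cocompact z hlim
  rw [hT z (hRV z hz)] at h0
  exact sub_eq_zero.1 h0

end Contour

end EllipticBailey

end

/-! ### Circles, separating contours and residues at simple poles -/

noncomputable section

namespace EllipticBailey

open Metric MeasureTheory

namespace ClosedCurve

theorem hasDerivAt_circleMap_two_pi (c : ℂ) (r s : ℝ) :
    HasDerivAt (fun s : ℝ => circleMap c r (2 * Real.pi * s))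
      ((2 * Real.pi) • deriv (circleMap c r) (2 * Real.pi * s)) s := by
  have h : HasDerivAt (fun s : ℝ => circleMap c r (2 * Real.pi * s)) _ s :=
    (differentiable_circleMap c r (2 * Real.pi * s)).hasDerivAt.scomp s
      ((hasDerivAt_id s).const_mul (2 * Real.pi))
  simpa using h

/-- The circle with centre `c` and radius `r`, traversed once counterclockwise. -/
def circle (c : ℂ) (r : ℝ) : ClosedCurve where
  toFun s := circleMap c r (2 * Real.pi * s)
  continuousOn := by fun_prop
  closed := by simpa using (periodic_circleMap c r 0).symm
  breaks := ∅
  differentiableAt s _ := (hasDerivAt_circleMap_two_pi c r s).differentiableAt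
  continuousOn_deriv := by
    simp only [funext fun s => (hasDerivAt_circleMap_two_pi c r s).deriv, deriv_circleMap]
    fun_prop
  integrable_deriv := by
    simp only [funext fun s => (hasDerivAt_circleMap_two_pi c r s).deriv, deriv_circleMap]
    exact Continuous.intervalIntegrable (by fun_prop) _ _

theorem integral_circle (c : ℂ) (r : ℝ) (f : ℂ → ℂ) :
    ∫ s in (0 : ℝ)..1, f ((circle c r).toFun s) * deriv (circle c r).toFun s =
      ∮ z in C(c, r), f z := by
  have h := intervalIntegral.smul_integral_comp_mul_left
    (fun θ => deriv (circleMap c r) θ • f (circleMap c r θ)) (2 * Real.pi) (a := 0) (b := 1)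
  rw [mul_zero, mul_one] at h
  rw [circleIntegral, ← h, ← intervalIntegral.integral_smul]
  refine intervalIntegral.integral_congr fun s _ => ?_
  simp only [circle, (hasDerivAt_circleMap_two_pi c r s).deriv, smul_eq_mul, Complex.real_smul]
  ring

theorem image_circle_subset {c : ℂ} {r : ℝ} (hr : 0 ≤ r) : (circle c r).image ⊆ sphere c r := by
  rintro _ ⟨s, _, rfl⟩
  exact circleMap_mem_sphere c hr _

end ClosedCurve

namespace Contour

/-- The sum of the circles with centres in a finite set `F` and radii `δ`. -/
def circles (F : Finset ℂ) (δ : ℂ → ℝ) : Contour :=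
  F.toList.map fun w => ClosedCurve.circle w (δ w)

theorem integral_circles (F : Finset ℂ) (δ : ℂ → ℝ) (f : ℂ → ℂ) :
    (circles F δ).integral f = ∑ w ∈ F, ∮ z in C(w, δ w), f z := by
  simp only [circles, Contour.integral, List.map_map, Function.comp_def,
    ClosedCurve.integral_circle, Finset.sum_map_toList]

theorem exists_of_mem_support_circles {F : Finset ℂ} {δ : ℂ → ℝ} (hδ : ∀ w ∈ F, 0 < δ w) {u : ℂ}
    (hu : u ∈ (circles F δ).support) : ∃ w ∈ F, u ∈ sphere w (δ w) := by
  obtain ⟨γ, hγ, s, hs, rfl⟩ := hu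
  obtain ⟨w, hw, rfl⟩ := List.mem_map.1 hγ
  rw [Finset.mem_toList] at hw
  exact ⟨w, hw, ClosedCurve.image_circle_subset (hδ w hw).le (Set.mem_image_of_mem _ hs)⟩

theorem circleIntegral_inv_sub_of_notMem {c u : ℂ} {r : ℝ} (hr : 0 ≤ r) (hu : u ∉ closedBall c r) :
    (∮ z in C(c, r), (z - u)⁻¹) = 0 := by
  have hd : DifferentiableOn ℂ (fun z => (z - u)⁻¹) (closedBall c r) :=
    DifferentiableOn.inv (by fun_prop) fun z hz h => hu ((sub_eq_zero.1 h : z = u) ▸ hz)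
  exact (hd.mono closure_ball_subset_closedBall).diffContOnCl.circleIntegral_eq_zero hr

open Classical in
theorem winding_circles {F : Finset ℂ} {δ : ℂ → ℝ} (hδ : ∀ w ∈ F, 0 < δ w) {u : ℂ}
    (hu : ∀ w ∈ F, u ≠ w → u ∉ closedBall w (δ w)) :
    u ∉ (circles F δ).support ∧ (circles F δ).winding u = if u ∈ F then 1 else 0 := by
  constructor
  · intro h
    obtain ⟨w, hw, hs⟩ := exists_of_mem_support_circles hδ h
    refine hu w hw ?_ (sphere_subset_closedBall hs)
    rintro rfl
    rw [mem_sphere, dist_self] at hs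
    exact (hδ u hw).ne hs
  · have key : ∀ w ∈ F, (∮ z in C(w, δ w), (z - u)⁻¹) =
        if u = w then 2 * Real.pi * Complex.I else 0 := by
      intro w hw
      split_ifs with h
      · subst h
        exact circleIntegral.integral_sub_inv_of_mem_ball (mem_ball_self (hδ u hw))
      · exact circleIntegral_inv_sub_of_notMem (hδ w hw).le (hu w hw h)
    have h2 : (2 * Real.pi * Complex.I : ℂ) ≠ 0 := Complex.two_pi_I_ne_zero
    rw [Contour.winding, integral_circles, Finset.sum_congr rfl key, Finset.sum_ite_eq]
    split_ifs
    · exact inv_mul_cancel₀ h2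
    · simp

/-- Only points of I of norm at least |w| / 2 and points of O of norm at most 2 |w| can be close to
w, and there are finitely many of both. -/
theorem exists_isolating_radius {I O : Set ℂ} (hI : ∀ r > 0, {w ∈ I | r ≤ ‖w‖}.Finite)
    (hO : ∀ R, {w ∈ O | ‖w‖ ≤ R}.Finite) {w : ℂ} (hw : w ≠ 0) :
    ∃ δ > 0, ∀ u ∈ I ∪ O, u ≠ w → u ∉ closedBall w δ := by
  have hw0 : 0 < ‖w‖ := norm_pos_iff.2 hw
  have hT := (((hI (‖w‖ / 2) (half_pos hw0)).union (hO (2 * ‖w‖))).subset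
    (Set.sdiff_subset (t := {w}))).isClosed
  obtain ⟨ε, hε, hsub⟩ := Metric.isOpen_iff.1 hT.isOpen_compl w (by simp)
  refine ⟨min (ε / 2) (‖w‖ / 4), lt_min (half_pos hε) (by linarith), fun u hu huw hmem => ?_⟩
  have h1 : dist u w ≤ ε / 2 := (mem_closedBall.1 hmem).trans (min_le_left _ _)
  have h2 : ‖u - w‖ ≤ ‖w‖ / 4 := by
    rw [← dist_eq_norm]
    exact (mem_closedBall.1 hmem).trans (min_le_right _ _)
  refine hsub (mem_ball.2 (by linarith : dist u w < ε)) ⟨?_, huw⟩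
  rcases hu with hu | hu
  · refine Or.inl ⟨hu, ?_⟩
    have := norm_sub_norm_le w u
    rw [norm_sub_rev] at this
    linarith
  · refine Or.inr ⟨hu, ?_⟩
    linarith [norm_sub_norm_le u w]

/-- Two disjoint discrete sets, the first one accumulating only at the origin and the second one
only at infinity, are separated by a contour. -/
theorem exists_separates {I O : Set ℂ} (h0 : 0 ∈ I) (hI : ∀ r > 0, {w ∈ I | r ≤ ‖w‖}.Finite)
    (hO : ∀ R, {w ∈ O | ‖w‖ ≤ R}.Finite) (hdisj : ∀ w ∈ I, w ∉ O) :
    ∃ C : Contour, C.Separates I O := by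
  classical
  obtain ⟨r₀, hr₀, hr₀O⟩ := Metric.isOpen_iff.1 (hO 1).isClosed.isOpen_compl 0
    fun h => hdisj 0 h0 h.1
  -- A radius so small that the disc misses O (the bound 1 makes `hO 1` applicable), and different
  -- from the finitely many norms of points of I in this range.
  obtain ⟨r, ⟨hr1, hr2⟩, hrn⟩ := (Set.Ioo_infinite (show min r₀ 1 / 2 < min r₀ 1 from
    half_lt_self (lt_min hr₀ one_pos))).exists_notMem_finite
    ((hI (min r₀ 1 / 2) (half_pos (lt_min hr₀ one_pos))).image norm)
  have hrpos : 0 < r := (half_pos (lt_min hr₀ one_pos)).trans hr1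
  have hrI : ∀ w ∈ I, ‖w‖ ≠ r := fun w hw h =>
    hrn ⟨w, ⟨hw, h ▸ hr1.le⟩, h⟩
  have hrO : ∀ w ∈ O, w ∉ closedBall (0 : ℂ) r := fun w hw h => by
    rw [mem_closedBall, dist_zero_right] at h
    refine hr₀O (a := w) ?_ ⟨hw, h.trans (hr2.le.trans (min_le_right _ _))⟩
    rw [mem_ball, dist_zero_right]
    exact h.trans_lt (hr2.trans_le (min_le_left _ _))
  let F : Finset ℂ := (hI r hrpos).toFinset
  have hF : ∀ w, w ∈ F ↔ w ∈ I ∧ r ≤ ‖w‖ := fun w => by simp [F]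
  have hF0 : ∀ w ∈ F, w ≠ 0 := fun w hw h => by
    have := ((hF w).1 hw).2
    rw [h, norm_zero] at this
    linarith
  choose! δ hδ hδ' using fun w (hw : w ∈ F) => exists_isolating_radius hI hO (hF0 w hw)
  have hF0' : (0 : ℂ) ∉ F := fun h => hF0 0 h rfl
  have hwF := fun u (hu : u ∈ I ∪ O) => winding_circles hδ (u := u) fun w hw hne => hδ' w hw u hu hne
  have hz : ∀ u, u ∉ sphere (0 : ℂ) r → u ∉ (circles {0} fun _ => r).support := fun u hu h => by
    obtain ⟨w, hw, hs⟩ := exists_of_mem_support_circles (fun _ _ => hrpos) h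
    rw [Finset.mem_singleton.1 hw] at hs
    exact hu hs
  have hz0 : ∀ u, u ∉ closedBall (0 : ℂ) r → (circles {0} fun _ => r).winding u = 0 :=
    fun u hu => by
      rw [Contour.winding, integral_circles, Finset.sum_singleton,
        circleIntegral_inv_sub_of_notMem hrpos.le hu, mul_zero]
  -- The circle of radius r takes care of the origin and of all but finitely many points of I; each
  -- remaining point gets a small circle of its own.
  refine ⟨(circles {0} fun _ => r) ++ circles F δ, fun u hu => ?_, fun u hu => ?_⟩
  · have hs : u ∉ sphere (0 : ℂ) r := by simpa using hrI u hu
    rw [support_append, winding_append, (hwF u (Or.inl hu)).2]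
    refine ⟨fun h => h.elim (hz u hs) (hwF u (Or.inl hu)).1, ?_⟩
    by_cases huF : u ∈ F
    · have hub : u ∉ closedBall (0 : ℂ) r := by
        rw [mem_closedBall, dist_zero_right, not_le]
        exact lt_of_le_of_ne ((hF u).1 huF).2 (hrI u hu).symm
      rw [if_pos huF, hz0 u hub, zero_add]
    · have hub : u ∈ ball (0 : ℂ) r := by
        rw [mem_ball, dist_zero_right]
        by_contra h
        exact huF ((hF u).2 ⟨hu, not_lt.1 h⟩)
      rw [if_neg huF, add_zero, Contour.winding, integral_circles, Finset.sum_singleton,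
        circleIntegral.integral_sub_inv_of_mem_ball hub,
        inv_mul_cancel₀ Complex.two_pi_I_ne_zero]
  · have hub := hrO u hu
    have huF : u ∉ F := fun h => hdisj u ((hF u).1 h).1 hu
    rw [support_append, winding_append, (hwF u (Or.inr hu)).2, hz0 u hub, if_neg huF, add_zero]
    exact ⟨fun h => h.elim (hz u fun h => hub (sphere_subset_closedBall h))
      (hwF u (Or.inr hu)).1, rfl⟩

/-- The residue theorem for a circle about an at most simple pole. -/
theorem circleIntegral_eq_of_tendsto {f : ℂ → ℂ} {s c : ℂ} {δ : ℝ} (hδ : 0 < δ)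
    (hf : ∀ z ∈ closedBall s δ, z ≠ s → DifferentiableAt ℂ f z)
    (hlim : Tendsto (fun z => (z - s) * f z) (𝓝[≠] s) (𝓝 c)) :
    (∮ z in C(s, δ), f z) = 2 * Real.pi * Complex.I * c := by
  -- With the value c inserted at s, (z - s) f(z) is continuous there, and Cauchy's formula at s
  -- evaluates the integral.
  have hg : ∀ z ∈ closedBall s δ, z ≠ s →
      DifferentiableAt ℂ (Function.update (fun z => (z - s) * f z) s c) z := by
    intro z hz hne
    refine (DifferentiableAt.mul (by fun_prop) (hf z hz hne) :
      DifferentiableAt ℂ (fun z => (z - s) * f z) z).congr_of_eventuallyEq ?_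
    filter_upwards [isOpen_ne.mem_nhds hne] with w hw
    rw [Function.update_of_ne hw]
    rfl
  have h := Complex.circleIntegral_sub_inv_smul_of_differentiable_on_off_countable
    (f := Function.update (fun z => (z - s) * f z) s c) (Set.countable_singleton s)
    (mem_ball_self hδ) (fun z hz => ?_) fun z hz => hg z (ball_subset_closedBall hz.1) hz.2
  · rw [Function.update_self, smul_eq_mul] at h
    rw [← h]
    refine circleIntegral.integral_congr hδ.le fun z hz => ?_
    have hne : z ≠ s := by
      rintro rfl
      rw [mem_sphere, dist_self] at hz
      exact hδ.ne hz
    simp only [Function.update_of_ne hne, smul_eq_mul]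
    rw [inv_mul_cancel_left₀ (sub_ne_zero.2 hne)]
  · rcases eq_or_ne z s with rfl | hne
    · exact (continuousAt_update_same.2 hlim).continuousWithinAt
    · exact (hg z hz hne).continuousAt.continuousWithinAt

end Contour

end EllipticBailey

end

/-! ### Infinite products and q-Pochhammer symbols -/

noncomputable section

namespace EllipticBailey

section InfiniteProducts

variable {ι : Type*} {c : ι → ℂ}

theorem multipliable_one_sub_mul (hc : Summable fun i => ‖c i‖) (z : ℂ) :
    Multipliable fun i => 1 - z * c i := by
  simp_rw [sub_eq_add_neg]
  refine multipliable_one_add_of_summable ?_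
  simpa using hc.mul_left ‖z‖

theorem tprod_one_sub_mul_eq_zero_iff (hc : Summable fun i => ‖c i‖) (z : ℂ) :
    ∏' i, (1 - z * c i) = 0 ↔ ∃ i, z * c i = 1 := by
  refine ⟨fun h => ?_, fun ⟨i, hi⟩ => tprod_of_exists_eq_zero ⟨i, by rw [hi, sub_self]⟩⟩
  by_contra! hne
  refine tprod_one_add_ne_zero_of_summable (f := fun i => -(z * c i)) (fun i hi => hne i ?_) ?_
    (by simpa only [← sub_eq_add_neg] using h)
  · linear_combination -hi
  · simpa using hc.mul_left ‖z‖

theorem differentiable_tprod_one_sub_mul (hc : Summable fun i => ‖c i‖) :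
    Differentiable ℂ fun z => ∏' i, (1 - z * c i) := by
  intro z
  have hball : IsOpen (Metric.ball (0 : ℂ) (‖z‖ + 1)) := Metric.isOpen_ball
  have h := Summable.hasProdLocallyUniformlyOn_one_add (f := fun i z => -(z * c i)) hball
    (hc.mul_left (‖z‖ + 1)) (Eventually.of_forall fun i w hw => ?_) fun i => by fun_prop
  · simp_rw [← sub_eq_add_neg] at h
    refine (h.differentiableOn (.of_forall fun s => ?_) hball).differentiableAt
      (hball.mem_nhds (by simp))
    simpa [Finset.prod_fn] using DifferentiableOn.finsetProd (fun _ _ => by fun_prop)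
  · rw [mem_ball_zero_iff] at hw
    rw [norm_neg, norm_mul]
    exact mul_le_mul_of_nonneg_right hw.le (norm_nonneg _)

end InfiniteProducts

section QPochhammer

variable {p q : ℂ}

theorem summable_norm_pow (hq : ‖q‖ < 1) : Summable fun j : ℕ => ‖q ^ j‖ := by
  simpa using summable_geometric_of_lt_one (norm_nonneg q) hq

theorem qPochInf_eq_zero_iff (hq : ‖q‖ < 1) (z : ℂ) :
    qPochInf z q = 0 ↔ ∃ j : ℕ, z * q ^ j = 1 :=
  tprod_one_sub_mul_eq_zero_iff (summable_norm_pow hq) z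

theorem differentiable_qPochInf (hq : ‖q‖ < 1) : Differentiable ℂ fun z => qPochInf z q :=
  differentiable_tprod_one_sub_mul (summable_norm_pow hq)

theorem qPochInf_eq_mul (hq : ‖q‖ < 1) (z : ℂ) :
    qPochInf z q = (1 - z) * qPochInf (z * q) q := by
  have h : ∀ j : ℕ, 1 - z * q ^ (j + 1) = 1 - z * q * q ^ j := fun j => by ring
  rw [qPochInf, tprod_eq_zero_mul', qPochInf]
  · simp only [h, pow_zero, mul_one]
  · simp only [h]
    exact multipliable_one_sub_mul (summable_norm_pow hq) (z * q)

theorem qPochInf_self_ne_zero (hq : ‖q‖ < 1) : qPochInf q q ≠ 0 := by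
  rw [Ne, qPochInf_eq_zero_iff hq]
  rintro ⟨j, hj⟩
  rw [← pow_succ'] at hj
  have h := pow_lt_one₀ (norm_nonneg q) hq (Nat.succ_ne_zero j)
  rw [← norm_pow, Nat.succ_eq_add_one, hj, norm_one] at h
  exact h.false

/-- The double infinite product `∏_{i, j ≥ 0} (1 - z p^i q^j)`. -/
def doublePochInf (p q z : ℂ) : ℂ := ∏' jk : ℕ × ℕ, (1 - z * p ^ jk.1 * q ^ jk.2)

theorem summable_norm_pow_mul_pow (hp : ‖p‖ < 1) (hq : ‖q‖ < 1) :
    Summable fun jk : ℕ × ℕ => ‖p ^ jk.1 * q ^ jk.2‖ :=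
  (summable_norm_pow hp).mul_norm (summable_norm_pow hq)

theorem doublePochInf_eq (p q z : ℂ) :
    doublePochInf p q z = ∏' jk : ℕ × ℕ, (1 - z * (p ^ jk.1 * q ^ jk.2)) := by
  simp only [doublePochInf, mul_assoc]

theorem doublePochInf_eq_zero_iff (hp : ‖p‖ < 1) (hq : ‖q‖ < 1) (z : ℂ) :
    doublePochInf p q z = 0 ↔ ∃ i j : ℕ, z * p ^ i * q ^ j = 1 := by
  rw [doublePochInf_eq, tprod_one_sub_mul_eq_zero_iff (summable_norm_pow_mul_pow hp hq),
    Prod.exists]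
  simp only [mul_assoc]

theorem doublePochInf_ne_zero (hp : ‖p‖ < 1) (hq : ‖q‖ < 1) {z : ℂ}
    (hz : ∀ i j : ℕ, z * q ^ i * p ^ j ≠ 1) : doublePochInf p q z ≠ 0 := by
  rw [Ne, doublePochInf_eq_zero_iff hp hq]
  rintro ⟨i, j, h⟩
  exact hz j i (by rw [← h]; ring)

theorem norm_pow_mul_pow_le_one (hp : ‖p‖ < 1) (hq : ‖q‖ < 1) (i j : ℕ) :
    ‖q ^ i * p ^ j‖ ≤ 1 := by
  rw [norm_mul, norm_pow, norm_pow]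
  exact mul_le_one₀ (pow_le_one₀ (norm_nonneg _) hq.le) (by positivity)
    (pow_le_one₀ (norm_nonneg _) hp.le)

theorem mul_pow_mul_pow_ne_one (hp : ‖p‖ < 1) (hq : ‖q‖ < 1) {z : ℂ} (hz : ‖z‖ < 1) (i j : ℕ) :
    z * q ^ i * p ^ j ≠ 1 := by
  intro h
  have h1 : ‖z‖ * ‖q ^ i * p ^ j‖ = 1 := by rw [← norm_mul, ← mul_assoc, h, norm_one]
  nlinarith [norm_pow_mul_pow_le_one hp hq i j, norm_nonneg z, norm_nonneg (q ^ i * p ^ j)]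

theorem doublePochInf_ne_zero_of_norm_lt_one (hp : ‖p‖ < 1) (hq : ‖q‖ < 1) {z : ℂ}
    (hz : ‖z‖ < 1) : doublePochInf p q z ≠ 0 :=
  doublePochInf_ne_zero hp hq (mul_pow_mul_pow_ne_one hp hq hz)

theorem differentiable_doublePochInf (hp : ‖p‖ < 1) (hq : ‖q‖ < 1) :
    Differentiable ℂ (doublePochInf p q) := by
  rw [funext (doublePochInf_eq p q)]
  exact differentiable_tprod_one_sub_mul (summable_norm_pow_mul_pow hp hq)

theorem doublePochInf_comm (p q z : ℂ) : doublePochInf p q z = doublePochInf q p z := by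
  rw [doublePochInf_eq, doublePochInf_eq, ← (Equiv.prodComm ℕ ℕ).tprod_eq]
  simp [mul_comm]

/-- The factors without a power of q form (z; p)_∞; in the remaining ones a factor q is absorbed
into z. -/
theorem doublePochInf_eq_mul (hp : ‖p‖ < 1) (hq : ‖q‖ < 1) (z : ℂ) :
    doublePochInf p q z = qPochInf z p * doublePochInf p q (z * q) := by
  have hrow : ∀ (w : ℂ) (i : ℕ), Multipliable fun j : ℕ => 1 - w * (p ^ i * q ^ j) := fun w i => by
    simpa only [mul_assoc] using multipliable_one_sub_mul (summable_norm_pow hq) (w * p ^ i)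
  have hprod : ∀ w, HasProd (fun i => ∏' j, (1 - w * (p ^ i * q ^ j))) (doublePochInf p q w) :=
    fun w => by
      rw [doublePochInf_eq]
      exact (multipliable_one_sub_mul (summable_norm_pow_mul_pow hp hq) w).hasProd.prod_fiberwise
        fun i => (hrow w i).hasProd
  refine (hprod z).unique ?_
  have h := (multipliable_one_sub_mul (summable_norm_pow hp) z).hasProd.mul (hprod (z * q))
  refine h.congr_fun fun i => ?_
  have hs : ∀ j : ℕ, 1 - z * (p ^ i * q ^ (j + 1)) = 1 - z * q * (p ^ i * q ^ j) := fun j => by ring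
  rw [tprod_eq_zero_mul']
  · simp only [hs, pow_zero, mul_one]
  · simp only [hs]
    exact hrow (z * q) i

theorem doublePochInf_eq_mul' (hp : ‖p‖ < 1) (hq : ‖q‖ < 1) (z : ℂ) :
    doublePochInf p q z = qPochInf z q * doublePochInf p q (z * p) := by
  rw [doublePochInf_comm, doublePochInf_eq_mul hq hp, doublePochInf_comm q p]

end QPochhammer

/-! ### The theta function -/

section Theta

variable {p : ℂ}

/-- After the first factors 1 - z and 1 - 1/z = -(1 - z)/z are split off, what is left is symmetric
under z ↦ 1/z. -/
theorem theta_inv (hp : ‖p‖ < 1) {z : ℂ} (hz : z ≠ 0) : theta z⁻¹ p = -z⁻¹ * theta z p := by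
  rw [theta, theta, qPochInf_eq_mul hp z, qPochInf_eq_mul hp z⁻¹, inv_inv, mul_comm p z,
    mul_comm z⁻¹ p]
  field_simp
  ring

theorem theta_ne_zero (hp : ‖p‖ < 1) {z : ℂ} (hz : z ≠ 0) (h1 : ∀ j : ℕ, z * p ^ j ≠ 1)
    (h2 : ∀ j : ℕ, z ≠ p ^ j) : theta z p ≠ 0 := by
  refine mul_ne_zero ?_ ?_
  · rw [Ne, qPochInf_eq_zero_iff hp]
    exact fun ⟨j, hj⟩ => h1 j hj
  · rw [Ne, qPochInf_eq_zero_iff hp]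
    rintro ⟨j, hj⟩
    refine h2 (j + 1) ?_
    field_simp at hj
    rw [← hj]
    ring

theorem theta_one (hp : ‖p‖ < 1) : theta 1 p = 0 := by
  rw [theta, (qPochInf_eq_zero_iff hp 1).2 ⟨0, by simp⟩, zero_mul]

theorem continuousAt_theta (hp : ‖p‖ < 1) {z : ℂ} (hz : z ≠ 0) :
    ContinuousAt (fun z => theta z p) z :=
  ((differentiable_qPochInf hp).continuous.continuousAt).mul
    ((differentiable_qPochInf hp).continuous.continuousAt.comp (f := fun z => p * z⁻¹)
      (continuousAt_const.mul (continuousAt_inv₀ hz)))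

end Theta

/-! ### The elliptic gamma function -/

section EllipticGamma

variable {p q : ℂ}

theorem ellGamma_eq (p q z : ℂ) :
    ellGamma p q z = doublePochInf p q (p * q * z⁻¹) / doublePochInf p q z := by
  have h : ∀ jk : ℕ × ℕ, 1 - z⁻¹ * p ^ (jk.1 + 1) * q ^ (jk.2 + 1) =
      1 - p * q * z⁻¹ * p ^ jk.1 * q ^ jk.2 := fun jk => by ring
  rw [ellGamma, tprod_congr h]
  rfl

theorem ellGamma_ne_zero (hp : ‖p‖ < 1) (hq : ‖q‖ < 1) {z : ℂ} (hz : z ≠ 0)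
    (h1 : ∀ i j : ℕ, z * q ^ i * p ^ j ≠ 1)
    (h2 : ∀ i j : ℕ, z ≠ q ^ (i + 1) * p ^ (j + 1)) : ellGamma p q z ≠ 0 := by
  rw [ellGamma_eq]
  refine div_ne_zero (doublePochInf_ne_zero hp hq fun i j h => h2 i j ?_)
    (doublePochInf_ne_zero hp hq h1)
  field_simp at h
  rw [← h]
  ring

theorem differentiableAt_ellGamma (hp : ‖p‖ < 1) (hq : ‖q‖ < 1) {z : ℂ} (hz : z ≠ 0)
    (h : ∀ i j : ℕ, z * q ^ i * p ^ j ≠ 1) : DifferentiableAt ℂ (ellGamma p q) z := by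
  rw [funext (ellGamma_eq p q)]
  exact ((differentiable_doublePochInf hp hq).differentiableAt.comp z
    (f := fun z => p * q * z⁻¹) ((differentiableAt_inv hz).const_mul _)).fun_div
    (differentiable_doublePochInf hp hq).differentiableAt (doublePochInf_ne_zero hp hq h)

/-- One layer of each double product splits off: the one in the denominator of Γ(z) gives (z; p)_∞,
the one in the numerator of Γ(qz) gives (p/z; p)_∞. The hypothesis excludes the points where
division by zero would falsify the identity. -/
theorem ellGamma_mul (hp : ‖p‖ < 1) (hq : ‖q‖ < 1) (hq0 : q ≠ 0) {z : ℂ}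
    (hz : ∀ j : ℕ, z * p ^ j ≠ 1) : ellGamma p q (z * q) = theta z p * ellGamma p q z := by
  have hz' : qPochInf z p ≠ 0 := by
    rw [Ne, qPochInf_eq_zero_iff hp]
    exact fun ⟨j, hj⟩ => hz j hj
  have hn : p * q * (z * q)⁻¹ = p * z⁻¹ := by
    rw [mul_inv]
    field_simp
  have hn' : p * z⁻¹ * q = p * q * z⁻¹ := by ring
  rw [ellGamma_eq, ellGamma_eq, hn, doublePochInf_eq_mul hp hq (p * z⁻¹), hn',
    doublePochInf_eq_mul hp hq z, theta]
  field_simp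

theorem ellGamma_mul_pow (hp : ‖p‖ < 1) (hq : ‖q‖ < 1) (hq0 : q ≠ 0) {z : ℂ}
    (hz : ∀ i j : ℕ, z * q ^ i * p ^ j ≠ 1) (n : ℕ) :
    ellGamma p q (z * q ^ n) = (∏ j ∈ Finset.range n, theta (z * q ^ j) p) * ellGamma p q z := by
  induction n with
  | zero => simp
  | succ n ih =>
    rw [pow_succ, ← mul_assoc, ellGamma_mul hp hq hq0 (hz n), ih, Finset.prod_range_succ]
    ring

/-- The elliptic gamma function has a simple pole at `1`. -/
theorem tendsto_one_sub_mul_ellGamma (hp : ‖p‖ < 1) (hq : ‖q‖ < 1) :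
    Tendsto (fun ε => (1 - ε) * ellGamma p q ε) (𝓝[≠] 1)
      (𝓝 (qPochInf p p * qPochInf q q)⁻¹) := by
  have hpq : ‖p * q‖ < 1 := by
    rw [norm_mul]
    exact mul_lt_one_of_nonneg_of_lt_one_left (norm_nonneg _) hp hq.le
  have hE : doublePochInf p q (p * q) ≠ 0 := doublePochInf_ne_zero_of_norm_lt_one hp hq hpq
  have hEq : doublePochInf p q q ≠ 0 := doublePochInf_ne_zero_of_norm_lt_one hp hq hq
  -- This is (1 - ε) Γ(ε) after the vanishing factor 1 - ε of the denominator has been cancelled.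
  have hcont : ContinuousAt (fun ε => doublePochInf p q (p * q * ε⁻¹) /
      (qPochInf (ε * p) p * doublePochInf p q (ε * q))) 1 := by
    refine ContinuousAt.div ?_ ?_ ?_
    · exact (differentiable_doublePochInf hp hq).continuous.continuousAt.comp
        (f := fun ε => p * q * ε⁻¹) (continuousAt_const.mul (continuousAt_inv₀ one_ne_zero))
    · have h1 := (differentiable_qPochInf hp).continuous
      have h2 := (differentiable_doublePochInf hp hq).continuous
      exact ((h1.comp (continuous_mul_const p)).mul (h2.comp (continuous_mul_const q))).continuousAt
    · rw [one_mul, one_mul]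
      exact mul_ne_zero (qPochInf_self_ne_zero hp) hEq
  have hval : doublePochInf p q (p * q * 1⁻¹) /
      (qPochInf (1 * p) p * doublePochInf p q (1 * q)) = (qPochInf p p * qPochInf q q)⁻¹ := by
    have h := doublePochInf_eq_mul' hp hq q
    rw [mul_comm q p] at h
    rw [inv_one, mul_one, one_mul, one_mul, h]
    have := qPochInf_self_ne_zero hp
    have := qPochInf_self_ne_zero hq
    field_simp
  have ht := hcont.tendsto.mono_left (nhdsWithin_le_nhds (s := {1}ᶜ))
  rw [hval] at ht
  refine ht.congr' ?_
  filter_upwards [self_mem_nhdsWithin] with ε hε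
  have h1 : 1 - ε ≠ 0 := sub_ne_zero.2 (Ne.symm hε)
  rw [ellGamma_eq, doublePochInf_eq_mul hp hq ε, qPochInf_eq_mul hp ε]
  rw [mul_assoc (1 - ε), ← mul_div_assoc, mul_div_mul_left _ _ h1]

/-- The analytic continuation of `1 / (Γ(w) Γ(1 / w))` to the punctured plane. -/
def gammaReflection (p q w : ℂ) : ℂ :=
  (qPochInf w p * qPochInf (w * q) q) * (qPochInf w⁻¹ p * qPochInf (w⁻¹ * q) q)

theorem gammaReflection_inv (p q w : ℂ) : gammaReflection p q w⁻¹ = gammaReflection p q w := by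
  rw [gammaReflection, gammaReflection, inv_inv, mul_comm]

/-- Two layers are removed; the second starts at wq since the corner factor 1 - w belongs to the
first. -/
theorem doublePochInf_eq_mul_mul (hp : ‖p‖ < 1) (hq : ‖q‖ < 1) (w : ℂ) :
    doublePochInf p q w =
      qPochInf w p * qPochInf (w * q) q * doublePochInf p q (p * q * w) := by
  rw [doublePochInf_eq_mul hp hq w, doublePochInf_eq_mul' hp hq (w * q),
    show w * q * p = p * q * w by ring]
  ring

/-- After the two layers are split off, the double products at pq w and pq/w cancel crosswise. Where
one of them vanishes the left side takes the default value of division by zero, hence the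
hypotheses. -/
theorem inv_ellGamma_mul_ellGamma_inv (hp : ‖p‖ < 1) (hq : ‖q‖ < 1) {w : ℂ}
    (h1 : doublePochInf p q (p * q * w) ≠ 0) (h2 : doublePochInf p q (p * q * w⁻¹) ≠ 0) :
    (ellGamma p q w * ellGamma p q w⁻¹)⁻¹ = gammaReflection p q w := by
  rw [ellGamma_eq, ellGamma_eq, inv_inv, div_mul_div_comm, inv_div,
    doublePochInf_eq_mul_mul hp hq w, doublePochInf_eq_mul_mul hp hq w⁻¹, gammaReflection,
    div_eq_iff (mul_ne_zero h2 h1)]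
  ring

theorem differentiableAt_gammaReflection (hp : ‖p‖ < 1) (hq : ‖q‖ < 1) {w : ℂ} (hw : w ≠ 0) :
    DifferentiableAt ℂ (gammaReflection p q) w := by
  have h1 := differentiable_qPochInf hp
  have h2 := differentiable_qPochInf hq
  have hi : DifferentiableAt ℂ (fun w : ℂ => w⁻¹) w := differentiableAt_inv hw
  exact (h1.differentiableAt.mul (h2.differentiableAt.comp w (f := fun w => w * q)
    (by fun_prop))).mul ((h1.differentiableAt.comp w (f := fun w => w⁻¹) hi).mul
      (h2.differentiableAt.comp w (f := fun w => w⁻¹ * q) (hi.mul_const q)))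

end EllipticGamma

/-! ### The kernel and its analytic continuation -/

section Kernel

variable {p q : ℂ}

/-- The kernel of the elliptic Fourier transform, continued analytically to the zeros of
`Γ(z^{±2})`. -/
def regKernel (p q t x z : ℂ) : ℂ :=
  ellGamma p q (t * x * z) * ellGamma p q (t * x * z⁻¹) *
      ellGamma p q (t * x⁻¹ * z) * ellGamma p q (t * x⁻¹ * z⁻¹) *
    (gammaReflection p q (z ^ 2) / ellGamma p q (t ^ 2))

theorem regKernel_inv (p q t x z : ℂ) : regKernel p q t x z⁻¹ = regKernel p q t x z := by
  rw [regKernel, regKernel, inv_inv, inv_pow, gammaReflection_inv]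
  ring

theorem kernel_eq_regKernel (hp : ‖p‖ < 1) (hq : ‖q‖ < 1) (t x : ℂ) {z : ℂ}
    (h1 : doublePochInf p q (p * q * z ^ 2) ≠ 0)
    (h2 : doublePochInf p q (p * q * z⁻¹ ^ 2) ≠ 0) :
    kernel p q t x z = regKernel p q t x z := by
  rw [inv_pow] at h2
  rw [kernel, regKernel, ← inv_ellGamma_mul_ellGamma_inv hp hq h1 h2, inv_pow]
  ring

theorem countable_setOf_sq_mem {D : Set ℂ} (hD : D.Countable) : {z : ℂ | z ^ 2 ∈ D}.Countable := by
  have h : (⋃ w ∈ D, {z : ℂ | z ^ 2 = w}).Countable := by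
    refine hD.biUnion fun w _ => ?_
    obtain ⟨s, hs⟩ := IsAlgClosed.exists_pow_nat_eq w two_pos
    refine (Set.toFinite {s, -s}).countable.mono fun z hz => ?_
    exact sq_eq_sq_iff_eq_or_eq_neg.1 (hz.trans hs.symm)
  exact h.mono fun z hz => Set.mem_iUnion₂.2 ⟨z ^ 2, hz, rfl⟩

/-- The points at which `kernel` need not have the value of its analytic continuation. -/
def kernelExceptional (p q : ℂ) : Set ℂ :=
  {z | doublePochInf p q (p * q * z ^ 2) = 0 ∨ doublePochInf p q (p * q * z⁻¹ ^ 2) = 0}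

theorem countable_kernelExceptional (hp : ‖p‖ < 1) (hq : ‖q‖ < 1) :
    (kernelExceptional p q).Countable := by
  have hD : {w : ℂ | doublePochInf p q (p * q * w) = 0}.Countable := by
    refine (Set.countable_range fun ij : ℕ × ℕ => (p * q * p ^ ij.1 * q ^ ij.2)⁻¹).mono
      fun w hw => ?_
    obtain ⟨i, j, h⟩ := (doublePochInf_eq_zero_iff hp hq _).1 hw
    refine ⟨(i, j), (eq_inv_of_mul_eq_one_right ?_).symm⟩
    rw [← h]
    ring
  have h2 := countable_setOf_sq_mem hD
  exact h2.union (h2.preimage inv_injective)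

theorem kernel_eq_regKernel_of_notMem (hp : ‖p‖ < 1) (hq : ‖q‖ < 1) (t x : ℂ) {z : ℂ}
    (hz : z ∉ kernelExceptional p q) : kernel p q t x z = regKernel p q t x z :=
  kernel_eq_regKernel hp hq t x (fun h => hz (Or.inl h)) fun h => hz (Or.inr h)

theorem kernelPoles_conditions {t x z : ℂ} (hz : z ≠ 0) (hP : z ∉ kernelPoles p q t x)
    (hP' : z⁻¹ ∉ kernelPoles p q t x) (i j : ℕ) :
    t * x * z * q ^ i * p ^ j ≠ 1 ∧ t * x * z⁻¹ * q ^ i * p ^ j ≠ 1 ∧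
      t * x⁻¹ * z * q ^ i * p ^ j ≠ 1 ∧ t * x⁻¹ * z⁻¹ * q ^ i * p ^ j ≠ 1 := by
  have hz' : z⁻¹ ≠ 0 := inv_ne_zero hz
  have key : ∀ c w : ℂ, w ≠ 0 → c * w * q ^ i * p ^ j = 1 → w⁻¹ = c * q ^ i * p ^ j :=
    fun c w hw h => by
      field_simp
      rw [← h]
      ring
  refine ⟨fun h => hP' ⟨i, j, Or.inl (key _ _ hz h)⟩, fun h => hP ⟨i, j, Or.inl ?_⟩,
    fun h => hP' ⟨i, j, Or.inr (key _ _ hz h)⟩, fun h => hP ⟨i, j, Or.inr ?_⟩⟩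
  · simpa using key _ _ hz' h
  · simpa using key _ _ hz' h

theorem differentiableAt_regKernel (hp : ‖p‖ < 1) (hq : ‖q‖ < 1) {t x z : ℂ} (ht : t ≠ 0)
    (hx : x ≠ 0) (hz : z ≠ 0) (hP : z ∉ kernelPoles p q t x) (hP' : z⁻¹ ∉ kernelPoles p q t x) :
    DifferentiableAt ℂ (regKernel p q t x) z := by
  have hi : DifferentiableAt ℂ (fun w : ℂ => w⁻¹) z := differentiableAt_inv hz
  have hc := kernelPoles_conditions hz hP hP'
  have h1 := (differentiableAt_ellGamma hp hq (mul_ne_zero (mul_ne_zero ht hx) hz)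
    fun i j => (hc i j).1).comp z (f := fun z => t * x * z) (by fun_prop)
  have h2 := (differentiableAt_ellGamma hp hq (mul_ne_zero (mul_ne_zero ht hx) (inv_ne_zero hz))
    fun i j => (hc i j).2.1).comp z (f := fun z => t * x * z⁻¹) (hi.const_mul _)
  have h3 := (differentiableAt_ellGamma hp hq (mul_ne_zero (mul_ne_zero ht (inv_ne_zero hx)) hz)
    fun i j => (hc i j).2.2.1).comp z (f := fun z => t * x⁻¹ * z) (by fun_prop)
  have h4 := (differentiableAt_ellGamma hp hq
    (mul_ne_zero (mul_ne_zero ht (inv_ne_zero hx)) (inv_ne_zero hz))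
    fun i j => (hc i j).2.2.2).comp z (f := fun z => t * x⁻¹ * z⁻¹) (hi.const_mul _)
  have h5 := (differentiableAt_gammaReflection hp hq (pow_ne_zero 2 hz)).comp z
    (f := fun z => z ^ 2) (by fun_prop)
  exact (((h1.mul h2).mul h3).mul h4).mul (h5.div_const _)

/-- Joint continuity in x and z gives bounds uniform along a compact contour when x varies. -/
theorem continuousAt_regKernel (hp : ‖p‖ < 1) (hq : ‖q‖ < 1) {t x z : ℂ} (ht : t ≠ 0)
    (hx : x ≠ 0) (hz : z ≠ 0) (hP : z ∉ kernelPoles p q t x) (hP' : z⁻¹ ∉ kernelPoles p q t x) :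
    ContinuousAt (fun w : ℂ × ℂ => regKernel p q t w.1 w.2) (x, z) := by
  have hc := kernelPoles_conditions hz hP hP'
  have c1 : ContinuousAt (fun w : ℂ × ℂ => w.1) (x, z) := continuousAt_fst
  have c2 : ContinuousAt (fun w : ℂ × ℂ => w.2) (x, z) := continuousAt_snd
  have i1 : ContinuousAt (fun w : ℂ × ℂ => w.1⁻¹) (x, z) := c1.inv₀ hx
  have i2 : ContinuousAt (fun w : ℂ × ℂ => w.2⁻¹) (x, z) := c2.inv₀ hz
  have h1 := (differentiableAt_ellGamma hp hq (mul_ne_zero (mul_ne_zero ht hx) hz)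
    fun i j => (hc i j).1).continuousAt.comp_of_eq ((continuousAt_const (y := t)).mul c1 |>.mul c2)
    rfl
  have h2 := (differentiableAt_ellGamma hp hq (mul_ne_zero (mul_ne_zero ht hx) (inv_ne_zero hz))
    fun i j => (hc i j).2.1).continuousAt.comp_of_eq
    ((continuousAt_const (y := t)).mul c1 |>.mul i2) rfl
  have h3 := (differentiableAt_ellGamma hp hq (mul_ne_zero (mul_ne_zero ht (inv_ne_zero hx)) hz)
    fun i j => (hc i j).2.2.1).continuousAt.comp_of_eq
    ((continuousAt_const (y := t)).mul i1 |>.mul c2) rfl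
  have h4 := (differentiableAt_ellGamma hp hq
    (mul_ne_zero (mul_ne_zero ht (inv_ne_zero hx)) (inv_ne_zero hz))
    fun i j => (hc i j).2.2.2).continuousAt.comp_of_eq
    ((continuousAt_const (y := t)).mul i1 |>.mul i2) rfl
  have h5 := (differentiableAt_gammaReflection hp hq
    (pow_ne_zero 2 hz)).continuousAt.comp_of_eq (c2.pow 2) rfl
  exact (((h1.mul h2).mul h3).mul h4).mul (h5.div_const _)

end Kernel

end EllipticBailey

end

/-! ### Discreteness of the poles and existence of contours -/

noncomputable section

namespace EllipticBailey

open Metric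

section Discrete

variable {p q : ℂ}

theorem tendsto_mul_pow_mul_pow (hp : ‖p‖ < 1) (hq : ‖q‖ < 1) (c : ℂ) :
    Tendsto (fun ij : ℕ × ℕ => c * q ^ ij.1 * p ^ ij.2) cofinite (𝓝 0) := by
  have h := (summable_norm_pow_mul_pow hq hp).of_norm.tendsto_cofinite_zero.const_mul c
  simpa only [mul_zero, ← mul_assoc] using h

theorem finite_setOf_le_norm_mul_pow (hp : ‖p‖ < 1) (hq : ‖q‖ < 1) (c : ℂ) {r : ℝ} (hr : 0 < r) :
    {w : ℂ | (∃ ij : ℕ × ℕ, c * q ^ ij.1 * p ^ ij.2 = w) ∧ r ≤ ‖w‖}.Finite := by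
  have h := (tendsto_mul_pow_mul_pow hp hq c).eventually (ball_mem_nhds 0 hr)
  refine ((eventually_cofinite.1 h).image fun ij : ℕ × ℕ => c * q ^ ij.1 * p ^ ij.2).subset ?_
  rintro _ ⟨⟨ij, rfl⟩, hw⟩
  refine ⟨ij, ?_, rfl⟩
  simpa using hw

/-- The points `c q^i p^j` do not accumulate at `1`. -/
theorem eventually_ne_mul_pow_mul_pow (hp : ‖p‖ < 1) (hq : ‖q‖ < 1) (c : ℂ) :
    ∀ᶠ ε in 𝓝[≠] (1 : ℂ), ∀ i j : ℕ, ε ≠ c * q ^ i * p ^ j := by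
  have hfin := (finite_setOf_le_norm_mul_pow hp hq c one_half_pos).subset
    (Set.sdiff_subset (t := {1}))
  have h1 : ∀ᶠ ε in 𝓝 (1 : ℂ), 1 / 2 < ‖ε‖ :=
    continuous_norm.continuousAt.eventually_const_lt (by norm_num)
  have h2 := hfin.isClosed.isOpen_compl.mem_nhds (x := (1 : ℂ)) (by simp)
  filter_upwards [nhdsWithin_le_nhds h1, nhdsWithin_le_nhds h2, self_mem_nhdsWithin]
    with ε hε1 hε2 hε3 i j h
  exact hε2 ⟨⟨⟨(i, j), h.symm⟩, hε1.le⟩, hε3⟩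

theorem kernelPoles_eq (p q t x : ℂ) :
    kernelPoles p q t x = Set.range (fun ij : ℕ × ℕ => t * x * q ^ ij.1 * p ^ ij.2) ∪
      Set.range fun ij : ℕ × ℕ => t * x⁻¹ * q ^ ij.1 * p ^ ij.2 := by
  ext w
  simp only [kernelPoles, Set.mem_ofPred_eq, Set.mem_union, Set.mem_range, Prod.exists,
    ← exists_or, eq_comm]

theorem finite_kernelPoles (hp : ‖p‖ < 1) (hq : ‖q‖ < 1) (t x : ℂ) {r : ℝ} (hr : 0 < r) :
    {w ∈ kernelPoles p q t x | r ≤ ‖w‖}.Finite := by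
  refine ((finite_setOf_le_norm_mul_pow hp hq (t * x) hr).union
    (finite_setOf_le_norm_mul_pow hp hq (t * x⁻¹) hr)).subset ?_
  rw [kernelPoles_eq]
  rintro w ⟨hw | hw, hr⟩
  · exact Or.inl ⟨hw, hr⟩
  · exact Or.inr ⟨hw, hr⟩

/-- The poles accumulate only at 0. Compactness lets one neighbourhood of ε = 1 serve all the
infinitely many poles. -/
theorem isCompact_insert_kernelPoles (hp : ‖p‖ < 1) (hq : ‖q‖ < 1) (t x : ℂ) :
    IsCompact (insert 0 (kernelPoles p q t x)) := by
  rw [kernelPoles_eq, Set.insert_union_distrib]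
  exact (tendsto_mul_pow_mul_pow hp hq _).isCompact_insert_range_of_cofinite.union
    (tendsto_mul_pow_mul_pow hp hq _).isCompact_insert_range_of_cofinite

theorem zero_notMem_kernelPoles (hp0 : p ≠ 0) (hq0 : q ≠ 0) {t x : ℂ} (ht : t ≠ 0) (hx : x ≠ 0) :
    (0 : ℂ) ∉ kernelPoles p q t x := by
  rintro ⟨i, j, h | h⟩
  · exact (mul_ne_zero (mul_ne_zero (mul_ne_zero ht hx) (pow_ne_zero i hq0))
      (pow_ne_zero j hp0)) h.symm
  · exact (mul_ne_zero (mul_ne_zero (mul_ne_zero ht (inv_ne_zero hx)) (pow_ne_zero i hq0))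
      (pow_ne_zero j hp0)) h.symm

/-- Inversion exchanges accumulation at 0 and at infinity. The origin has to be excluded because of
the convention 0⁻¹ = 0. -/
theorem finite_setOf_inv_mem {S : Set ℂ} (h0 : (0 : ℂ) ∉ S)
    (hS : ∀ r > 0, {w ∈ S | r ≤ ‖w‖}.Finite) (R : ℝ) :
    {w ∈ {w : ℂ | w⁻¹ ∈ S} | ‖w‖ ≤ R}.Finite := by
  rcases le_or_gt R 0 with hR | hR
  · refine Set.finite_empty.subset fun w hw => h0 ?_
    have : w = 0 := norm_le_zero_iff.1 (hw.2.trans hR)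
    simpa [this] using hw.1
  · refine ((hS R⁻¹ (inv_pos.2 hR)).preimage inv_injective.injOn).subset fun w hw => ⟨hw.1, ?_⟩
    have hw0 : w ≠ 0 := fun h => h0 (by simpa [h] using hw.1)
    rw [norm_inv]
    exact inv_anti₀ (norm_pos_iff.2 hw0) hw.2

theorem finite_sep_union {S A : Set ℂ} (hS : ∀ r > 0, {w ∈ S | r ≤ ‖w‖}.Finite) (hA : A.Finite) :
    ∀ r > 0, {w ∈ S ∪ A | r ≤ ‖w‖}.Finite := fun r hr => by
  refine ((hS r hr).union hA).subset ?_
  rintro w ⟨h | h, hr⟩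
  · exact Or.inl ⟨h, hr⟩
  · exact Or.inr h

theorem finite_sep_insert {S : Set ℂ} (hS : ∀ r > 0, {w ∈ S | r ≤ ‖w‖}.Finite) (a : ℂ) :
    ∀ r > 0, {w ∈ {a} ∪ S | r ≤ ‖w‖}.Finite := by
  rw [Set.union_comm]
  exact finite_sep_union hS (Set.finite_singleton a)

end Discrete

section Contours

variable {p q t x : ℂ} {A : Set ℂ}

theorem exists_isDefiningContour (hp0 : p ≠ 0) (hp : ‖p‖ < 1) (hq0 : q ≠ 0) (hq : ‖q‖ < 1)
    (ht : t ≠ 0) (hx : x ≠ 0) (hA : A.Finite) (hA0 : (0 : ℂ) ∉ A)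
    (hdisj : ∀ w ∈ kernelPoles p q t x ∪ A, w⁻¹ ∉ kernelPoles p q t x ∪ A) :
    ∃ C, IsDefiningContour p q t x A C := by
  have hfin := finite_sep_union (fun r hr => finite_kernelPoles hp hq t x hr) hA
  have h0 : (0 : ℂ) ∉ kernelPoles p q t x ∪ A := fun h =>
    h.elim (zero_notMem_kernelPoles hp0 hq0 ht hx) hA0
  refine Contour.exists_separates (by simp) ?_ (finite_setOf_inv_mem h0 hfin) fun w hw => ?_
  · rw [Set.union_assoc]
    exact finite_sep_insert hfin 0
  · rw [Set.union_assoc] at hw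
    rcases hw with rfl | hw
    · simpa using h0
    · exact hdisj w hw

/-- At the pinching point the reciprocals of A are themselves kernel poles, so the conditions on A
are already contained in separating the kernel poles from their reciprocals. -/
theorem exists_isDeformedContour (hp0 : p ≠ 0) (hp : ‖p‖ < 1) (hq0 : q ≠ 0) (hq : ‖q‖ < 1)
    (ht : t ≠ 0) (hx : x ≠ 0) (hAP : ∀ w ∈ A, w⁻¹ ∈ kernelPoles p q t x)
    (hdisj : ∀ w ∈ kernelPoles p q t x, w⁻¹ ∉ kernelPoles p q t x) :
    ∃ C, IsDeformedContour p q t x A C := by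
  have h0 := zero_notMem_kernelPoles hp0 hq0 ht hx
  have hfin := fun r hr => finite_kernelPoles hp hq t x (r := r) hr
  have hO : {w | w⁻¹ ∈ kernelPoles p q t x} ∪ A = {w | w⁻¹ ∈ kernelPoles p q t x} :=
    Set.union_eq_left.2 hAP
  have hI : kernelPoles p q t x ∪ {w | w⁻¹ ∈ A} = kernelPoles p q t x :=
    Set.union_eq_left.2 fun w hw => by simpa using hAP _ hw
  simp only [IsDeformedContour]
  rw [Set.union_assoc, hI, hO]
  refine Contour.exists_separates (by simp) (finite_sep_insert hfin 0)
    (finite_setOf_inv_mem h0 hfin) fun w hw => ?_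
  rcases hw with rfl | hw
  · simpa using h0
  · exact hdisj w hw

end Contours

/-! ### Independence of the contour -/

section Transform

variable {p q t x : ℂ} {A : Set ℂ} {α : ℂ → ℂ}

/-- `kernel` differs from its continuation at most on a countable set, where Γ(z^{±2}) vanishes, and
a contour may pass through such points without effect on the integral. -/
theorem eftIntegral_eq (hp : ‖p‖ < 1) (hq : ‖q‖ < 1) (t x : ℂ) (α : ℂ → ℂ) (C : Contour) :
    eftIntegral p q t x α C =
      kappa p q * C.integral fun z => regKernel p q t x z * α z / z := by
  rw [eftIntegral, C.integral_congr_of_countable (countable_kernelExceptional hp hq)]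
  intro z _ hz
  rw [kernel_eq_regKernel_of_notMem hp hq t x hz]

/-- The singularities of the integrand of the elliptic Fourier transform. -/
def singularSet (p q t x : ℂ) (A : Set ℂ) : Set ℂ :=
  {z | z = 0 ∨ z ∈ kernelPoles p q t x ∪ A ∨ z⁻¹ ∈ kernelPoles p q t x ∪ A}

theorem differentiableAt_integrand (hp : ‖p‖ < 1) (hq : ‖q‖ < 1) (ht : t ≠ 0) (hx : x ≠ 0)
    (hα : ∀ z, z ≠ 0 → z ∉ A → z⁻¹ ∉ A → DifferentiableAt ℂ α z) {z : ℂ}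
    (hz : z ∉ singularSet p q t x A) :
    DifferentiableAt ℂ (fun z => regKernel p q t x z * α z / z) z := by
  simp only [singularSet, Set.mem_ofPred_eq, Set.mem_union, not_or] at hz
  obtain ⟨h0, ⟨h1, h2⟩, h3, h4⟩ := hz
  exact ((differentiableAt_regKernel hp hq ht hx h0 h1 h3).mul (hα z h0 h2 h4)).fun_div
    differentiableAt_id h0

theorem exists_singularSet_radius (hp0 : p ≠ 0) (hp : ‖p‖ < 1) (hq0 : q ≠ 0) (hq : ‖q‖ < 1)
    (ht : t ≠ 0) (hx : x ≠ 0) (hA : A.Finite) (hA0 : (0 : ℂ) ∉ A) {w : ℂ} (hw : w ≠ 0) :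
    ∃ δ > 0, ∀ u ∈ singularSet p q t x A, u ≠ w → u ∉ closedBall w δ := by
  have hfin := finite_sep_union (fun r hr => finite_kernelPoles hp hq t x hr) hA
  have h0 : (0 : ℂ) ∉ kernelPoles p q t x ∪ A := fun h =>
    h.elim (zero_notMem_kernelPoles hp0 hq0 ht hx) hA0
  obtain ⟨δ, hδ, h⟩ := Contour.exists_isolating_radius (finite_sep_insert hfin 0)
    (finite_setOf_inv_mem h0 hfin) hw
  refine ⟨δ, hδ, fun u hu => h u ?_⟩
  rcases hu with hu | hu | hu
  · exact Or.inl (Or.inl hu)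
  · exact Or.inl (Or.inr hu)
  · exact Or.inr hu

theorem isOpen_compl_singularSet (hp0 : p ≠ 0) (hp : ‖p‖ < 1) (hq0 : q ≠ 0) (hq : ‖q‖ < 1)
    (ht : t ≠ 0) (hx : x ≠ 0) (hA : A.Finite) (hA0 : (0 : ℂ) ∉ A) :
    IsOpen (singularSet p q t x A)ᶜ := by
  refine Metric.isOpen_iff.2 fun w hw => ?_
  obtain ⟨δ, hδ, h⟩ := exists_singularSet_radius hp0 hp hq0 hq ht hx hA hA0
    (w := w) fun h => hw (Or.inl h)
  exact ⟨δ, hδ, fun u hu hus => h u hus (fun h => hw (h ▸ hus)) (ball_subset_closedBall hu)⟩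

theorem IsDefiningContour.winding_eq {C : Contour} (hC : IsDefiningContour p q t x A C) :
    (0 ∉ C.support ∧ C.winding 0 = 1) ∧
      (∀ w ∈ kernelPoles p q t x ∪ A, w ∉ C.support ∧ C.winding w = 1) ∧
      ∀ w, w⁻¹ ∈ kernelPoles p q t x ∪ A → w ∉ C.support ∧ C.winding w = 0 := by
  obtain ⟨h1, h2⟩ := hC
  rw [Set.union_assoc] at h1
  exact ⟨h1 0 (Or.inl rfl), fun w hw => h1 w (Or.inr hw), h2⟩

theorem IsDefiningContour.support_subset {C : Contour} (hC : IsDefiningContour p q t x A C) :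
    C.support ⊆ (singularSet p q t x A)ᶜ := by
  obtain ⟨h0, h1, h2⟩ := hC.winding_eq
  rintro z hz (rfl | h | h)
  · exact h0.1 hz
  · exact (h1 z h).1 hz
  · exact (h2 z h).1 hz

theorem IsDeformedContour.support_subset {C : Contour} (hC : IsDeformedContour p q t x A C) :
    C.support ⊆ (singularSet p q t x A)ᶜ := by
  obtain ⟨h1, h2⟩ := hC
  rintro z hz (rfl | (h | h) | (h | h))
  · exact (h1 0 (by simp)).1 hz
  · exact (h1 z (Or.inl (Or.inr h))).1 hz
  · exact (h2 z (Or.inr h)).1 hz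
  · exact (h2 z (Or.inl h)).1 hz
  · exact (h1 z (Or.inr h)).1 hz

/-- The elliptic Fourier transform does not depend on the choice of the contour. -/
theorem eftIntegral_eq_of_isDefiningContour (hp0 : p ≠ 0) (hp : ‖p‖ < 1) (hq0 : q ≠ 0)
    (hq : ‖q‖ < 1) (ht : t ≠ 0) (hx : x ≠ 0) (hA : A.Finite) (hA0 : (0 : ℂ) ∉ A)
    (hα : ∀ z, z ≠ 0 → z ∉ A → z⁻¹ ∉ A → DifferentiableAt ℂ α z) {C C' : Contour}
    (hC : IsDefiningContour p q t x A C) (hC' : IsDefiningContour p q t x A C') :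
    eftIntegral p q t x α C = eftIntegral p q t x α C' := by
  rw [eftIntegral_eq hp hq, eftIntegral_eq hp hq, C.integral_eq_of_winding_eq C'
    (isOpen_compl_singularSet hp0 hp hq0 hq ht hx hA hA0)
    (fun z hz => (differentiableAt_integrand hp hq ht hx hα hz).differentiableWithinAt)
    hC.support_subset hC'.support_subset]
  intro z hz
  rcases Set.notMem_compl_iff.1 hz with rfl | h | h
  · rw [hC.winding_eq.1.2, hC'.winding_eq.1.2]
  · rw [(hC.winding_eq.2.1 z h).2, (hC'.winding_eq.2.1 z h).2]
  · rw [(hC.winding_eq.2.2 z h).2, (hC'.winding_eq.2.2 z h).2]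

end Transform

/-! ### The residue sum -/

section Residues

variable {p q t x : ℂ} {α : ℂ → ℂ}

/-- The measure dz / z supplies (z - s) / z = 1 - s / z, the factor in the normalization of r. -/
theorem tendsto_integrand_residue (hp : ‖p‖ < 1) (hq : ‖q‖ < 1) (ht : t ≠ 0) (hx : x ≠ 0)
    {s r : ℂ} (hs : s ≠ 0) (hP : s ∉ kernelPoles p q t x) (hP' : s⁻¹ ∉ kernelPoles p q t x)
    (hr : Tendsto (fun z => (1 - s / z) * α z) (𝓝[≠] s) (𝓝 r)) :
    Tendsto (fun z => (z - s) * (regKernel p q t x z * α z / z)) (𝓝[≠] s)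
      (𝓝 (regKernel p q t x s * r)) := by
  have hK := ((differentiableAt_regKernel hp hq ht hx hs hP hP').continuousAt.tendsto.mono_left
    (nhdsWithin_le_nhds (s := {s}ᶜ))).mul hr
  refine hK.congr' ?_
  filter_upwards [nhdsWithin_le_nhds (isOpen_ne.mem_nhds hs)] with z hz
  have hz : z ≠ 0 := hz
  field_simp

/-- The kernel and α are invariant under z ↦ 1/z while dz / z changes sign, so the residue is
opposite to the one at s. -/
theorem tendsto_integrand_residue_inv (hp : ‖p‖ < 1) (hq : ‖q‖ < 1) (ht : t ≠ 0) (hx : x ≠ 0)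
    {s r : ℂ} (hs : s ≠ 0) (hP : s ∉ kernelPoles p q t x) (hP' : s⁻¹ ∉ kernelPoles p q t x)
    (hr : Tendsto (fun z => (1 - s / z) * α z) (𝓝[≠] s) (𝓝 r))
    (hsymm : ∀ᶠ z in 𝓝[≠] s⁻¹, α z⁻¹ = α z) :
    Tendsto (fun z => (z - s⁻¹) * (regKernel p q t x z * α z / z)) (𝓝[≠] s⁻¹)
      (𝓝 (-(regKernel p q t x s * r))) := by
  have hs' : s⁻¹ ≠ 0 := inv_ne_zero hs
  have hinv : Tendsto (fun z : ℂ => z⁻¹) (𝓝[≠] s⁻¹) (𝓝[≠] s) := by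
    refine tendsto_nhdsWithin_iff.2 ⟨?_, ?_⟩
    · have h := (tendsto_inv₀ hs').mono_left (nhdsWithin_le_nhds (s := {s⁻¹}ᶜ))
      rwa [inv_inv] at h
    · filter_upwards [self_mem_nhdsWithin] with z hz h
      exact hz (by rw [Set.mem_singleton_iff, ← (h : z⁻¹ = s), inv_inv])
  have hK : Tendsto (regKernel p q t x) (𝓝[≠] s⁻¹) (𝓝 (regKernel p q t x s)) := by
    rw [← regKernel_inv p q t x s]
    exact (differentiableAt_regKernel hp hq ht hx hs' hP'
      (by rwa [inv_inv])).continuousAt.tendsto.mono_left nhdsWithin_le_nhds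
  have hc : Tendsto (fun z : ℂ => -(z⁻¹ / s)) (𝓝[≠] s⁻¹) (𝓝 (-(s / s))) :=
    ((hinv.mono_right nhdsWithin_le_nhds).div_const s).neg
  have h := hK.mul (hc.mul (hr.comp hinv))
  rw [div_self hs, neg_one_mul, mul_neg] at h
  refine h.congr' ?_
  filter_upwards [nhdsWithin_le_nhds (isOpen_ne.mem_nhds hs'), hsymm] with z hz hz'
  have hz : z ≠ 0 := hz
  simp only [Function.comp_apply, hz']
  field_simp
  ring

/-- Moving the contour across the poles of `α` produces the sum of the residues. -/
theorem eftIntegral_eq_add_residues (hp0 : p ≠ 0) (hp : ‖p‖ < 1) (hq0 : q ≠ 0)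
    (hq : ‖q‖ < 1) (ht : t ≠ 0) (hx : x ≠ 0) {A : Finset ℂ} (hA0 : (0 : ℂ) ∉ A)
    (hα : ∀ z, z ≠ 0 → z ∉ A → z⁻¹ ∉ A → DifferentiableAt ℂ α z)
    (hsymm : ∀ z, z ≠ 0 → z ∉ A → z⁻¹ ∉ A → α z⁻¹ = α z) {r : ℂ → ℂ}
    (hr : ∀ s ∈ A, Tendsto (fun z => (1 - s / z) * α z) (𝓝[≠] s) (𝓝 (r s)))
    (hAe : ∀ s ∈ A, s ∉ kernelExceptional p q) {C C' : Contour}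
    (hC : IsDefiningContour p q t x A C) (hC' : IsDeformedContour p q t x A C') :
    eftIntegral p q t x α C = eftIntegral p q t x α C' +
      4 * Real.pi * Complex.I * kappa p q * ∑ s ∈ A, kernel p q t x s * r s := by
  classical
  have hA : (A : Set ℂ).Finite := A.finite_toSet
  obtain ⟨hw0, hw1, hw2⟩ := hC.winding_eq
  obtain ⟨hv1, hv2⟩ := hC'
  let B : Finset ℂ := A.image (·⁻¹)
  have hB : ∀ w, w ∈ B ↔ w⁻¹ ∈ A := fun w => by
    simp only [B, Finset.mem_image]
    exact ⟨fun ⟨a, ha, h⟩ => by rwa [← h, inv_inv], fun h => ⟨w⁻¹, h, inv_inv w⟩⟩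
  -- The required disjointness need not be assumed: a common point would have winding number both 0
  -- and 1.
  have hAP : ∀ s ∈ A, s ∉ kernelPoles p q t x := fun s hs h => by
    have h1 := (hv1 s (Or.inl (Or.inr h))).2
    rw [(hv2 s (Or.inr hs)).2] at h1
    exact zero_ne_one h1
  have hAP' : ∀ s ∈ A, s⁻¹ ∉ kernelPoles p q t x := fun s hs h => by
    have h1 := (hw1 s (Or.inr hs)).2
    rw [(hw2 s (Or.inl h)).2] at h1
    exact zero_ne_one h1
  have hAA : ∀ s ∈ A, s⁻¹ ∉ A := fun s hs h => by
    have h1 := (hw1 s (Or.inr hs)).2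
    rw [(hw2 s (Or.inr h)).2] at h1
    exact zero_ne_one h1
  have hA0' : ∀ s ∈ A, s ≠ 0 := fun s hs h => hA0 (h ▸ hs)
  have hB0 : ∀ s ∈ B, s ≠ 0 := fun s hs h => hA0 (by simpa [h] using (hB s).1 hs)
  have hex : ∀ w : ℂ, w ≠ 0 → ∃ δ > 0, ∀ u ∈ singularSet p q t x A, u ≠ w → u ∉ closedBall w δ :=
    fun w hw => exists_singularSet_radius hp0 hp hq0 hq ht hx hA hA0 hw
  choose! δ hδ hδ' using hex
  set G : ℂ → ℂ := fun z => regKernel p q t x z * α z / z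
  have hGd : ∀ z ∉ singularSet p q t x A, DifferentiableAt ℂ G z := fun z hz =>
    differentiableAt_integrand hp hq ht hx hα hz
  have hsupp : ∀ F : Finset ℂ, (∀ s ∈ F, s ≠ 0) →
      (Contour.circles F δ).support ⊆ (singularSet p q t x A)ᶜ := fun F hF0 u hu huS => by
    obtain ⟨w, hw, hs⟩ := Contour.exists_of_mem_support_circles (fun w hw => hδ w (hF0 w hw)) hu
    refine hδ' w (hF0 w hw) u huS ?_ (sphere_subset_closedBall hs)
    rintro rfl
    rw [mem_sphere, dist_self] at hs
    exact (hδ u (hF0 u hw)).ne hs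
  have hwind : ∀ F : Finset ℂ, (∀ s ∈ F, s ≠ 0) → ∀ u ∈ singularSet p q t x A,
      (Contour.circles F δ).winding u = if u ∈ F then 1 else 0 := fun F hF0 u hu =>
    (Contour.winding_circles (fun w hw => hδ w (hF0 w hw))
      fun w hw hne => hδ' w (hF0 w hw) u hu hne).2
  -- C winds about A and C' about the reciprocals of A; adding circles about the points that each
  -- one misses makes the winding numbers equal at every singularity.
  have hcauchy : Contour.integral (C ++ Contour.circles B δ) G =
      Contour.integral (C' ++ Contour.circles A δ) G := by
    refine Contour.integral_eq_of_winding_eq _ _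
      (isOpen_compl_singularSet hp0 hp hq0 hq ht hx hA hA0)
      (fun z hz => (hGd z hz).differentiableWithinAt) ?_ ?_ fun u hu => ?_
    · rw [Contour.support_append]
      exact Set.union_subset hC.support_subset (hsupp B hB0)
    · rw [Contour.support_append]
      exact Set.union_subset (IsDeformedContour.support_subset ⟨hv1, hv2⟩) (hsupp A hA0')
    · have hu := Set.notMem_compl_iff.1 hu
      rw [Contour.winding_append, Contour.winding_append, hwind A hA0' u hu, hwind B hB0 u hu]
      simp only [hB]
      rcases hu with rfl | (h | h) | (h | h)
      · rw [hw0.2, (hv1 0 (by simp)).2, inv_zero]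
      · rw [(hw1 u (Or.inl h)).2, (hv1 u (Or.inl (Or.inr h))).2, if_neg fun h' => hAP u h' h,
          if_neg fun h' => hAP' _ h' (by rwa [inv_inv])]
      · rw [(hw1 u (Or.inr h)).2, (hv2 u (Or.inr h)).2, if_neg (hAA u h), if_pos (by exact h)]
        ring
      · rw [(hw2 u (Or.inl h)).2, (hv2 u (Or.inl h)).2, if_neg fun h' => hAP' u h' h,
          if_neg fun h' => hAP _ h' h]
      · rw [(hw2 u (Or.inr h)).2, (hv1 u (Or.inr h)).2, if_neg fun h' => hAA u h' h,
          if_pos (by exact h)]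
        ring
  have hcA : (Contour.circles A δ).integral G =
      2 * Real.pi * Complex.I * ∑ s ∈ A, kernel p q t x s * r s := by
    rw [Contour.integral_circles, Finset.mul_sum]
    refine Finset.sum_congr rfl fun s hs => ?_
    rw [kernel_eq_regKernel_of_notMem hp hq t x (hAe s hs)]
    exact Contour.circleIntegral_eq_of_tendsto (hδ s (hA0' s hs))
      (fun z hz hne => hGd z fun h => hδ' s (hA0' s hs) z h hne hz)
      (tendsto_integrand_residue hp hq ht hx (hA0' s hs) (hAP s hs) (hAP' s hs) (hr s hs))
  have hcB : (Contour.circles B δ).integral G =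
      -(2 * Real.pi * Complex.I * ∑ s ∈ A, kernel p q t x s * r s) := by
    rw [Contour.integral_circles, Finset.sum_image inv_injective.injOn, Finset.mul_sum,
      ← Finset.sum_neg_distrib]
    refine Finset.sum_congr rfl fun s hs => ?_
    have hs0 := inv_ne_zero (hA0' s hs)
    rw [kernel_eq_regKernel_of_notMem hp hq t x (hAe s hs), ← mul_neg]
    have hns : ∀ z ∈ closedBall s⁻¹ (δ s⁻¹), z ≠ s⁻¹ → z ∉ singularSet p q t x A :=
      fun z hz hne h => hδ' _ hs0 z h hne hz
    refine Contour.circleIntegral_eq_of_tendsto (hδ _ hs0) (fun z hz hne => hGd z (hns z hz hne))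
      (tendsto_integrand_residue_inv hp hq ht hx (hA0' s hs) (hAP s hs) (hAP' s hs) (hr s hs) ?_)
    filter_upwards [nhdsWithin_le_nhds (closedBall_mem_nhds _ (hδ _ hs0)),
      self_mem_nhdsWithin] with z hz hne
    have h := hns z hz hne
    exact hsymm z (fun h' => h (Or.inl h')) (fun h' => h (Or.inr (Or.inl (Or.inr h'))))
      fun h' => h (Or.inr (Or.inr (Or.inr h')))
  rw [Contour.integral_append, Contour.integral_append, hcA, hcB] at hcauchy
  rw [eftIntegral_eq hp hq, eftIntegral_eq hp hq]
  linear_combination kappa p q * hcauchy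

end Residues

end EllipticBailey

end

/-! ### Stability of deformed contours near the pinching point -/

noncomputable section

namespace EllipticBailey

open Metric

section Deformation

variable {p q t x : ℂ} {A : Set ℂ} {α : ℂ → ℂ}

theorem mem_kernelPoles_inv_mul {ε w : ℂ} (hw : w ∈ kernelPoles p q t (ε⁻¹ * x)) :
    ∃ u ∈ kernelPoles p q t x, w = ε⁻¹ * u ∨ w = ε * u := by
  obtain ⟨i, j, rfl | rfl⟩ := hw
  · exact ⟨_, ⟨i, j, Or.inl rfl⟩, Or.inl (by ring)⟩
  · refine ⟨_, ⟨i, j, Or.inr rfl⟩, Or.inr ?_⟩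
    rw [mul_inv, inv_inv]
    ring

/-- The origin stands for the point at infinity: reciprocals of small u lie outside a disc
containing the contour, where the winding number is 0. -/
theorem isOpen_setOf_inv_winding_eq_zero (C : Contour) :
    IsOpen {u : ℂ | u = 0 ∨ u⁻¹ ∉ C.support ∧ C.winding u⁻¹ = 0} := by
  refine isOpen_iff_mem_nhds.2 fun u hu => ?_
  rcases eq_or_ne u 0 with rfl | hu0
  · obtain ⟨R, hR⟩ := C.isCompact_support.isBounded.subset_closedBall 0
    have hpos : 0 < |R| + 1 := by positivity
    filter_upwards [ball_mem_nhds (0 : ℂ) (inv_pos.2 hpos)] with v hv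
    rcases eq_or_ne v 0 with rfl | hv0
    · exact Or.inl rfl
    · refine Or.inr (C.winding_eq_zero_of_norm_lt hR ?_)
      rw [mem_ball_zero_iff] at hv
      rw [norm_inv]
      have h := (lt_inv_comm₀ hpos (norm_pos_iff.2 hv0)).2 hv
      linarith [le_abs_self R]
  · have hV := (C.isOpen_setOf_winding_eq 0).mem_nhds (hu.resolve_left hu0)
    filter_upwards [(continuousAt_inv₀ hu0).preimage_mem_nhds hV] with v hv
    exact Or.inr hv

/-- A deformed contour stays one under a small change of the variable. -/
theorem IsDeformedContour.eventually (hp0 : p ≠ 0) (hp : ‖p‖ < 1) (hq0 : q ≠ 0) (hq : ‖q‖ < 1)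
    (ht : t ≠ 0) (hx : x ≠ 0) {C : Contour} (hC : IsDeformedContour p q t x A C) :
    ∀ᶠ ε in 𝓝 (1 : ℂ), IsDeformedContour p q t (ε⁻¹ * x) A C := by
  obtain ⟨h1, h2⟩ := hC
  -- The open set of admissible positions of a kernel pole: encircled once, with reciprocal not
  -- encircled. It contains the compact set of poles and 0 at ε = 1, hence also the poles scaled by
  -- ε and ε⁻¹ for ε near 1.
  let Ω : Set ℂ := {u | u ∉ C.support ∧ C.winding u = 1} ∩
    {u | u = 0 ∨ u⁻¹ ∉ C.support ∧ C.winding u⁻¹ = 0}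
  have hΩ : IsOpen Ω := (C.isOpen_setOf_winding_eq 1).inter (isOpen_setOf_inv_winding_eq_zero C)
  have hPΩ : ∀ u ∈ insert 0 (kernelPoles p q t x), u ∈ Ω := by
    rintro u (rfl | hu)
    · exact ⟨h1 0 (by simp), Or.inl rfl⟩
    · exact ⟨h1 u (Or.inl (Or.inr hu)), Or.inr (h2 u⁻¹ (Or.inl (by
        show u⁻¹⁻¹ ∈ kernelPoles p q t x
        rwa [inv_inv])))⟩
  have hev : ∀ᶠ ε in 𝓝 (1 : ℂ), ∀ u ∈ insert 0 (kernelPoles p q t x),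
      ε⁻¹ * u ∈ Ω ∧ ε * u ∈ Ω := by
    refine (isCompact_insert_kernelPoles hp hq t x).eventually_forall_of_forall_eventually
      fun u hu => ?_
    have c1 : ContinuousAt (fun z : ℂ × ℂ => z.1⁻¹ * z.2) (1, u) :=
      (continuousAt_fst.inv₀ one_ne_zero).mul continuousAt_snd
    have c2 : ContinuousAt (fun z : ℂ × ℂ => z.1 * z.2) (1, u) :=
      continuousAt_fst.mul continuousAt_snd
    exact (c1.eventually_mem (hΩ.mem_nhds (by simpa using hPΩ u hu))).and
      (c2.eventually_mem (hΩ.mem_nhds (by simpa using hPΩ u hu)))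
  filter_upwards [hev, isOpen_ne.mem_nhds (one_ne_zero : (1 : ℂ) ≠ 0)] with ε hε hε0
  have hmem : ∀ w ∈ kernelPoles p q t (ε⁻¹ * x), w ∈ Ω := fun w hw => by
    obtain ⟨u, hu, rfl | rfl⟩ := mem_kernelPoles_inv_mul hw
    · exact (hε u (Or.inr hu)).1
    · exact (hε u (Or.inr hu)).2
  refine ⟨?_, ?_⟩
  · rintro w ((hw | hw) | hw)
    · exact h1 w (Or.inl (Or.inl hw))
    · exact (hmem w hw).1
    · exact h1 w (Or.inr hw)
  · rintro w (hw | hw)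
    · rcases (hmem _ hw).2 with h | h
      · have hw' : w⁻¹ ∈ kernelPoles p q t (ε⁻¹ * x) := hw
        rw [h] at hw'
        exact absurd hw' (zero_notMem_kernelPoles hp0 hq0 ht (mul_ne_zero (inv_ne_zero hε0) hx))
      · rwa [inv_inv] at h
    · exact h2 w (Or.inr hw)

/-- Along a deformed contour the integral stays bounded near the pinching point. -/
theorem tendsto_one_sub_mul_eftIntegral (hp : ‖p‖ < 1) (hq : ‖q‖ < 1)
    (ht : t ≠ 0) (hx : x ≠ 0) (hα : ∀ z, z ≠ 0 → z ∉ A → z⁻¹ ∉ A → DifferentiableAt ℂ α z)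
    {C : Contour} (hC : IsDeformedContour p q t x A C) :
    Tendsto (fun ε => (1 - ε) * eftIntegral p q t (ε⁻¹ * x) α C) (𝓝[≠] (1 : ℂ)) (𝓝 0) := by
  have hsub := hC.support_subset
  have hS : ∀ z ∈ C.support, z ≠ 0 ∧ z ∉ kernelPoles p q t x ∧ z⁻¹ ∉ kernelPoles p q t x ∧
      z ∉ A ∧ z⁻¹ ∉ A := fun z hz => by
    have h := hsub hz
    simp only [singularSet, Set.mem_compl_iff, Set.mem_ofPred_eq, Set.mem_union, not_or] at h
    tauto
  have hcont : ∀ z ∈ C.support, ContinuousAt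
      (fun w : ℂ × ℂ => regKernel p q t (w.1⁻¹ * x) w.2 * α w.2 / w.2) (1, z) := by
    intro z hz
    obtain ⟨h0, h1, h2, h3, h4⟩ := hS z hz
    have c1 : ContinuousAt (fun w : ℂ × ℂ => (w.1⁻¹ * x, w.2)) (1, z) :=
      ((continuousAt_fst.inv₀ one_ne_zero).mul_const x).prodMk continuousAt_snd
    have c2 := (continuousAt_regKernel hp hq ht hx h0 h1 h2).comp_of_eq c1 (by simp)
    have c3 := (hα z h0 h3 h4).continuousAt.comp_of_eq
      (continuousAt_snd : ContinuousAt (Prod.snd : ℂ × ℂ → ℂ) (1, z)) rfl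
    exact (c2.mul c3).div continuousAt_snd h0
  have hcont1 : ContinuousOn (fun z => regKernel p q t (1⁻¹ * x) z * α z / z) C.support :=
    fun z hz => ((hcont z hz).comp_of_eq (f := fun z : ℂ => ((1 : ℂ), z))
      (continuousAt_const.prodMk continuousAt_id) rfl).continuousWithinAt
  obtain ⟨M, hM⟩ := C.isCompact_support.exists_bound_of_continuousOn hcont1
  have hbd : ∀ᶠ ε in 𝓝 (1 : ℂ), ∀ z ∈ C.support,
      ‖regKernel p q t (ε⁻¹ * x) z * α z / z‖ ≤ |M| + 1 := by
    refine C.isCompact_support.eventually_forall_of_forall_eventually fun z hz => ?_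
    refine ((hcont z hz).norm.eventually_lt_const ?_).mono fun w hw => hw.le
    exact (hM z hz).trans_lt (by linarith [le_abs_self M])
  obtain ⟨L, hL, hCL⟩ := C.exists_norm_integral_le
  refine squeeze_zero_norm' (a := fun ε => ‖1 - ε‖ * (‖kappa p q‖ * ((|M| + 1) * L))) ?_ ?_
  · filter_upwards [nhdsWithin_le_nhds hbd] with ε hε
    rw [eftIntegral_eq hp hq, norm_mul, norm_mul]
    exact mul_le_mul_of_nonneg_left (mul_le_mul_of_nonneg_left (hCL _ _ (by positivity) hε)
      (norm_nonneg _)) (norm_nonneg _)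
  · have h : ContinuousAt (fun ε : ℂ => ‖1 - ε‖ * (‖kappa p q‖ * ((|M| + 1) * L))) 1 := by
      fun_prop
    have h' := h.tendsto.mono_left (nhdsWithin_le_nhds (s := {1}ᶜ))
    simpa using h'

end Deformation

/-! ### Residues of the gamma function and theta product identities -/

section Limit

variable {p q : ℂ}

theorem ellPoch_natCast (p q z : ℂ) (n : ℕ) :
    ellPoch p q z n = ∏ j ∈ Finset.range n, theta (z * q ^ j) p := rfl

theorem tendsto_inv_punctured_one : Tendsto (fun ε : ℂ => ε⁻¹) (𝓝[≠] 1) (𝓝[≠] 1) := by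
  refine tendsto_nhdsWithin_iff.2 ⟨?_, ?_⟩
  · have h := (tendsto_inv₀ (one_ne_zero : (1 : ℂ) ≠ 0)).mono_left
      (nhdsWithin_le_nhds (s := {1}ᶜ))
    rwa [inv_one] at h
  · filter_upwards [self_mem_nhdsWithin] with ε hε h
    exact hε (inv_eq_one.1 h)

/-- The residue of the elliptic gamma function at `q^{-n}`. -/
theorem tendsto_one_sub_mul_ellGamma_mul_inv_pow (hp : ‖p‖ < 1) (hq : ‖q‖ < 1) (hq0 : q ≠ 0)
    {n : ℕ} (hθ : ∀ j < n, theta ((q ^ n)⁻¹ * q ^ j) p ≠ 0) :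
    Tendsto (fun ε => (1 - ε) * ellGamma p q (ε * (q ^ n)⁻¹)) (𝓝[≠] 1)
      (𝓝 ((qPochInf p p * qPochInf q q)⁻¹ /
        ∏ j ∈ Finset.range n, theta ((q ^ n)⁻¹ * q ^ j) p)) := by
  have hqn : q ^ n ≠ 0 := pow_ne_zero n hq0
  have hprod : Tendsto (fun ε => ∏ j ∈ Finset.range n, theta (ε * (q ^ n)⁻¹ * q ^ j) p) (𝓝[≠] 1)
      (𝓝 (∏ j ∈ Finset.range n, theta ((q ^ n)⁻¹ * q ^ j) p)) := by
    refine tendsto_finsetProd _ fun j _ => ?_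
    have h0 : (q ^ n)⁻¹ * q ^ j ≠ 0 := mul_ne_zero (inv_ne_zero hqn) (pow_ne_zero j hq0)
    have hc : ContinuousAt (fun ε : ℂ => theta (ε * (q ^ n)⁻¹ * q ^ j) p) 1 :=
      (continuousAt_theta hp h0).comp_of_eq (f := fun ε : ℂ => ε * (q ^ n)⁻¹ * q ^ j)
        (by fun_prop) (by ring)
    have := hc.tendsto.mono_left (nhdsWithin_le_nhds (s := {1}ᶜ))
    rwa [one_mul] at this
  have hne : ∏ j ∈ Finset.range n, theta ((q ^ n)⁻¹ * q ^ j) p ≠ 0 :=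
    Finset.prod_ne_zero_iff.2 fun j hj => hθ j (Finset.mem_range.1 hj)
  refine ((tendsto_one_sub_mul_ellGamma hp hq).div hprod hne).congr' ?_
  filter_upwards [tendsto_inv_punctured_one.eventually
    (eventually_ne_mul_pow_mul_pow hp hq (q ^ n)⁻¹), hprod.eventually_ne hne,
    nhdsWithin_le_nhds (isOpen_ne.mem_nhds (one_ne_zero : (1 : ℂ) ≠ 0))] with ε hε hε' hε0
  have hε0 : ε ≠ 0 := hε0
  have h := ellGamma_mul_pow hp hq hq0 (z := ε * (q ^ n)⁻¹) (fun i j hij => hε i j ?_) n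
  · rw [inv_mul_cancel_right₀ hqn] at h
    rw [Pi.div_apply, h, div_eq_iff hε']
    ring
  · rw [inv_eq_of_mul_eq_one_right]
    rw [← hij]
    ring

theorem tendsto_ellGamma_comp (hp : ‖p‖ < 1) (hq : ‖q‖ < 1) {c : ℂ} (hc : c ≠ 0)
    (h : ∀ i j : ℕ, c * q ^ i * p ^ j ≠ 1) {f : ℂ → ℂ} (hf : Tendsto f (𝓝[≠] 1) (𝓝 1)) :
    Tendsto (fun ε => ellGamma p q (f ε * c)) (𝓝[≠] 1) (𝓝 (ellGamma p q c)) := by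
  have h1 := hf.mul_const c
  rw [one_mul] at h1
  exact (differentiableAt_ellGamma hp hq hc h).continuousAt.tendsto.comp h1

/-- The exponents 2m + 2j + 2 add up to (m + n)(m + n + 1) - m(m + 1), which is the source of the
normalizing powers q^{N(N+1)} and q^{m(m+1)}. -/
theorem prod_exponents (a q : ℂ) (m n : ℕ) :
    (∏ j ∈ Finset.range n, (a * q ^ (2 * m + 2 * j + 2))) * q ^ (m * (m + 1)) =
      a ^ n * q ^ ((m + n) * (m + n + 1)) := by
  induction n with
  | zero => simp
  | succ n ih =>
    rw [Finset.prod_range_succ, mul_right_comm, ih]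
    ring

/-- Read backwards, the arguments on the left are the reciprocals of b q^(j+1), to which the
inversion formula applies. -/
theorem prod_theta_inv (hp : ‖p‖ < 1) (hq0 : q ≠ 0) {b : ℂ} (hb : b ≠ 0) (n : ℕ) :
    ∏ j ∈ Finset.range n, theta ((b * q ^ n)⁻¹ * q ^ j) p =
      ∏ j ∈ Finset.range n, (-(b * q ^ (j + 1))⁻¹ * theta (b * q ^ (j + 1)) p) := by
  rw [← Finset.prod_range_reflect]
  refine Finset.prod_congr rfl fun j hj => ?_
  have hj := Finset.mem_range.1 hj
  rw [← theta_inv hp (mul_ne_zero hb (pow_ne_zero _ hq0))]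
  congr 1
  have : q ^ n = q ^ (n - 1 - j) * q ^ (j + 1) := by
    rw [← pow_add]
    congr 1
    omega
  rw [this]
  field_simp

/-- The product of the theta factors in the residues, in terms of the matrix normalization. -/
theorem prod_theta_residue (hp : ‖p‖ < 1) (hq0 : q ≠ 0) {a : ℂ} (ha0 : a ≠ 0) (m n : ℕ) :
    (∏ j ∈ Finset.range n, theta ((q ^ n)⁻¹ * q ^ j) p) *
        (∏ j ∈ Finset.range n, theta ((a * q ^ (2 * m + n))⁻¹ * q ^ j) p) *
        (a ^ n * q ^ ((m + n) * (m + n + 1))) =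
      q ^ (m * (m + 1)) * (∏ j ∈ Finset.range n, theta (q * q ^ j) p) *
        ∏ j ∈ Finset.range n, theta (a * q ^ (2 * m + 1 + j)) p := by
  -- Used with b = 1 and b = a q^(2m): the signs cancel in pairs, and the prefactors combine to (a
  -- q^(2m+2j+2))⁻¹.
  have h1 := prod_theta_inv (p := p) hp hq0 one_ne_zero n
  have h2 := prod_theta_inv hp hq0 (mul_ne_zero ha0 (pow_ne_zero (2 * m) hq0)) n
  simp only [one_mul] at h1
  rw [mul_assoc a, ← pow_add] at h2
  rw [h1, h2, ← prod_exponents, ← Finset.prod_mul_distrib, ← mul_assoc, ← Finset.prod_mul_distrib,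
    mul_assoc (q ^ (m * (m + 1))), ← Finset.prod_mul_distrib, mul_comm]
  congr 1
  refine Finset.prod_congr rfl fun j _ => ?_
  rw [show a * q ^ (2 * m) * q ^ (j + 1) = a * q ^ (2 * m + 1 + j) by ring,
    show q ^ (j + 1) = q * q ^ j by ring]
  field_simp
  ring

/-- Both sides are the product of θ(a q^j; p) over 0 ≤ j ≤ 2m + n, split after j = 0 on the left and
around j = 2m on the right. -/
theorem prod_theta_split (a : ℂ) (m n : ℕ) :
    theta a p * ∏ j ∈ Finset.range (m + n + m), theta (q * a * q ^ j) p =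
      (∏ j ∈ Finset.range (2 * m), theta (a * q ^ j) p) * theta (a * q ^ (2 * m)) p *
        ∏ j ∈ Finset.range n, theta (a * q ^ (2 * m + 1 + j)) p := by
  have h : ∏ j ∈ Finset.range (m + n + m + 1), theta (a * q ^ j) p =
      theta a p * ∏ j ∈ Finset.range (m + n + m), theta (q * a * q ^ j) p := by
    rw [Finset.prod_range_succ', mul_comm, pow_zero, mul_one]
    congr 1
    refine Finset.prod_congr rfl fun j _ => ?_
    congr 1
    ring
  rw [← h, show m + n + m + 1 = 2 * m + 1 + n by ring, Finset.prod_range_add,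
    Finset.prod_range_succ]

end Limit

end EllipticBailey

end

/-! ### The limit of the kernel at a pole of α -/

noncomputable section

namespace EllipticBailey

section KernelLimit

variable {p q : ℂ}

/-- Here N = m + n. The factor Γ(ε q^(-n)) isolates the pole at ε = 1. -/
theorem kernel_at_pole (hq0 : q ≠ 0) {ra rk ε : ℂ} (hra : ra ≠ 0) (hrk : rk ≠ 0) (hε : ε ≠ 0)
    (m n : ℕ) :
    kernel p q (rk / ra) (ε⁻¹ * (rk * q ^ (m + n))) (ra * q ^ m) =
      ellGamma p q (ε⁻¹ * (rk ^ 2 * q ^ (m + n + m))) *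
          ellGamma p q (ε⁻¹ * (rk ^ 2 / ra ^ 2 * q ^ n)) *
          ellGamma p q (ε * (q ^ n)⁻¹) * ellGamma p q (ε * (ra ^ 2 * q ^ (2 * m + n))⁻¹) /
        (ellGamma p q (rk ^ 2 / ra ^ 2) *
          (ellGamma p q (ra ^ 2 * q ^ (2 * m)) * ellGamma p q (ra ^ 2 * q ^ (2 * m))⁻¹)) := by
  have e1 : rk / ra * (ε⁻¹ * (rk * q ^ (m + n))) * (ra * q ^ m) =
      ε⁻¹ * (rk ^ 2 * q ^ (m + n + m)) := by
    field_simp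
    ring
  have e2 : rk / ra * (ε⁻¹ * (rk * q ^ (m + n))) * (ra * q ^ m)⁻¹ =
      ε⁻¹ * (rk ^ 2 / ra ^ 2 * q ^ n) := by
    field_simp
    ring
  have e3 : rk / ra * (ε⁻¹ * (rk * q ^ (m + n)))⁻¹ * (ra * q ^ m) = ε * (q ^ n)⁻¹ := by
    field_simp
    ring
  have e4 : rk / ra * (ε⁻¹ * (rk * q ^ (m + n)))⁻¹ * (ra * q ^ m)⁻¹ =
      ε * (ra ^ 2 * q ^ (2 * m + n))⁻¹ := by
    field_simp
    ring
  have e5 : (ra * q ^ m) ^ 2 = ra ^ 2 * q ^ (2 * m) := by ring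
  rw [kernel, e1, e2, e3, e4, inv_pow, e5, div_pow]

theorem theta_pow_ne_zero (hp : ‖p‖ < 1) (hq : ‖q‖ < 1) (hq0 : q ≠ 0) {i : ℕ} (hi : 1 ≤ i)
    (hpq : ∀ j : ℕ, q ^ i ≠ p ^ j) : theta (q ^ i) p ≠ 0 := by
  refine theta_ne_zero hp (pow_ne_zero i hq0) (fun j h => ?_) hpq
  have h1 : ‖q ^ i‖ < 1 := by
    rw [norm_pow]
    exact pow_lt_one₀ (norm_nonneg q) hq (by omega)
  exact mul_pow_mul_pow_ne_one hp hq h1 0 j (by rw [pow_zero, mul_one, h])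

/-- The coefficient with which a pole of `α` contributes to the limit. -/
theorem tendsto_one_sub_mul_kernel (hp : ‖p‖ < 1) (hq : ‖q‖ < 1) (hq0 : q ≠ 0)
    {ra rk : ℂ} (hra0 : ra ≠ 0) (hrk0 : rk ≠ 0) (hra1 : ‖ra‖ < 1) (m n : ℕ)
    (hpq : ∀ i j : ℕ, 1 ≤ i → i ≤ n → q ^ i ≠ p ^ j)
    (hka : ∀ i j : ℕ, rk ^ 2 / ra ^ 2 * q ^ i * p ^ j ≠ 1)
    (hka' : ∀ i j : ℕ, rk ^ 2 / ra ^ 2 ≠ q ^ (i + 1) * p ^ (j + 1))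
    (hk : ∀ i j : ℕ, rk ^ 2 * q ^ i * p ^ j ≠ 1)
    (ha : ∀ i j : ℕ, ra ^ 2 * q ^ (2 * (m + n)) ≠ q ^ i * p ^ j) :
    Tendsto (fun ε => (1 - ε) *
        kernel p q (rk / ra) (ε⁻¹ * (rk * q ^ (m + n))) (ra * q ^ m)) (𝓝[≠] 1)
      (𝓝 ((qPochInf p p * qPochInf q q)⁻¹ * (q ^ ((m + n) * (m + n + 1)) *
        (baileyMatrix p q (ra ^ 2) (rk ^ 2) (m + n) m * ((q ^ (m * (m + 1)))⁻¹ *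
          (ellGamma p q (rk ^ 2) / ellGamma p q (ra ^ 2))))))) := by
  set a := ra ^ 2 with ha_def
  set k := rk ^ 2
  have ha0 : a ≠ 0 := pow_ne_zero 2 hra0
  have hk0 : k ≠ 0 := pow_ne_zero 2 hrk0
  have ha1 : ‖a‖ < 1 := by
    rw [ha_def, norm_pow]
    exact pow_lt_one₀ (norm_nonneg _) hra1 two_ne_zero
  have haq1 : ∀ l : ℕ, ‖a * q ^ l‖ < 1 := fun l => by
    rw [norm_mul a, norm_pow q]
    exact mul_lt_one_of_nonneg_of_lt_one_left (norm_nonneg _) ha1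
      (pow_le_one₀ (norm_nonneg _) hq.le)
  have haq0 : ∀ l : ℕ, a * q ^ l ≠ 0 := fun l => mul_ne_zero ha0 (pow_ne_zero l hq0)
  -- The genericity of a q^(2N) passes down to a q^l for l ≤ 2N on multiplying by q^(2N - l).
  have ha' : ∀ l ≤ 2 * (m + n), ∀ i j : ℕ, a * q ^ l ≠ q ^ i * p ^ j := fun l hl i j h => by
    refine ha (i + (2 * (m + n) - l)) j ?_
    rw [pow_add, mul_right_comm, ← h, mul_assoc, ← pow_add, Nat.add_sub_cancel' hl]
  have hθa : ∀ l ≤ 2 * (m + n), theta (a * q ^ l) p ≠ 0 := fun l hl => by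
    refine theta_ne_zero hp (haq0 l) (fun j h => ?_) fun j h => ?_
    · exact mul_pow_mul_pow_ne_one hp hq (haq1 l) 0 j (by rw [pow_zero, mul_one, h])
    · exact ha' l hl 0 j (by rw [h, pow_zero, one_mul])
  have hinv : ∀ l ≤ 2 * (m + n), ∀ i j : ℕ, (a * q ^ l)⁻¹ * q ^ i * p ^ j ≠ 1 :=
    fun l hl i j h => ha' l hl i j (by
      have := haq0 l
      field_simp at h
      rw [h])
  have hθq : ∀ j < n, theta ((q ^ n)⁻¹ * q ^ j) p ≠ 0 := fun j hj => by
    have hjn : (q ^ n)⁻¹ * q ^ j = (q ^ (n - j))⁻¹ := by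
      rw [show q ^ n = q ^ (n - j) * q ^ j by rw [← pow_add]; congr 1; omega]
      field_simp
    rw [hjn, theta_inv hp (pow_ne_zero _ hq0)]
    exact mul_ne_zero (neg_ne_zero.2 (inv_ne_zero (pow_ne_zero _ hq0)))
      (theta_pow_ne_zero hp hq hq0 (by omega) fun l => hpq _ l (by omega) (by omega))
  have hshift : ∀ (c : ℂ) (l : ℕ), (∀ i j : ℕ, c * q ^ i * p ^ j ≠ 1) →
      ∀ i j : ℕ, c * q ^ l * q ^ i * p ^ j ≠ 1 := fun c l hc i j h =>
    hc (l + i) j (by rw [← h]; ring)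
  have hid : Tendsto (fun ε : ℂ => ε) (𝓝[≠] 1) (𝓝 1) := nhdsWithin_le_nhds
  have hinv1 := tendsto_inv_punctured_one.mono_right nhdsWithin_le_nhds
  have t1 := tendsto_ellGamma_comp hp hq (mul_ne_zero hk0 (pow_ne_zero (m + n + m) hq0))
    (hshift k _ hk) hinv1
  have t2 := tendsto_ellGamma_comp hp hq
    (mul_ne_zero (div_ne_zero hk0 ha0) (pow_ne_zero n hq0)) (hshift (k / a) _ hka) hinv1
  have t3 := tendsto_one_sub_mul_ellGamma_mul_inv_pow hp hq hq0 hθq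
  have t4 := tendsto_ellGamma_comp hp hq (inv_ne_zero (haq0 (2 * m + n)))
    (hinv _ (by omega)) hid
  have hlim := (((t1.mul t2).mul t3).mul t4).div_const (ellGamma p q (k / a) *
    (ellGamma p q (a * q ^ (2 * m)) * ellGamma p q (a * q ^ (2 * m))⁻¹))
  -- All q-shifts are turned into theta products. `g6` is based at (a q^(2m+n))⁻¹, so that the gamma
  -- value in the denominator becomes a multiple of the one in the numerator and cancels.
  have g1 := ellGamma_mul_pow hp hq hq0 hk (m + n + m)
  have g2 := ellGamma_mul_pow hp hq hq0 hka n
  have g5 := ellGamma_mul_pow hp hq hq0 (mul_pow_mul_pow_ne_one hp hq ha1) (2 * m)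
  have g6 := ellGamma_mul_pow hp hq hq0 (hinv (2 * m + n) (by omega)) n
  have hq2 : (a * q ^ (2 * m + n))⁻¹ * q ^ n = (a * q ^ (2 * m))⁻¹ := by
    rw [pow_add]
    field_simp
  rw [hq2] at g6
  have hΓ4 : ellGamma p q (a * q ^ (2 * m + n))⁻¹ ≠ 0 := by
    refine ellGamma_ne_zero hp hq (inv_ne_zero (haq0 _)) (hinv _ (by omega)) fun i j h => ?_
    refine mul_pow_mul_pow_ne_one hp hq (haq1 (2 * m + n)) (i + 1) (j + 1) ?_
    rw [mul_assoc _ (q ^ (i + 1)), ← h, mul_inv_cancel₀ (haq0 _)]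
  have hΓka : ellGamma p q (k / a) ≠ 0 := ellGamma_ne_zero hp hq (div_ne_zero hk0 ha0) hka hka'
  have hR := prod_theta_residue hp hq0 ha0 m n
  have hS := prod_theta_split (p := p) (q := q) a m n
  have hθ0 : theta a p ≠ 0 := by simpa using hθa 0 (by omega)
  have hθ2 := hθa (2 * m) (by omega)
  have hD3 : ∏ j ∈ Finset.range n, theta ((q ^ n)⁻¹ * q ^ j) p ≠ 0 :=
    Finset.prod_ne_zero_iff.2 fun j hj => hθq j (Finset.mem_range.1 hj)
  have hY : ∏ j ∈ Finset.range n, theta (a * q ^ (2 * m + 1 + j)) p ≠ 0 :=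
    Finset.prod_ne_zero_iff.2 fun j hj => hθa _ (by have := Finset.mem_range.1 hj; omega)
  have hT5 : ∏ j ∈ Finset.range (2 * m), theta (a * q ^ j) p ≠ 0 :=
    Finset.prod_ne_zero_iff.2 fun j hj => hθa _ (by have := Finset.mem_range.1 hj; omega)
  have hbailey : baileyMatrix p q a k (m + n) m =
      ((∏ j ∈ Finset.range (m + n + m), theta (k * q ^ j) p) *
          ∏ j ∈ Finset.range n, theta (k / a * q ^ j) p) /
        ((∏ j ∈ Finset.range (m + n + m), theta (q * a * q ^ j) p) *
          ∏ j ∈ Finset.range n, theta (q * q ^ j) p) *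
      (theta (a * q ^ (2 * m)) p / theta a p) * a ^ n := by
    have h1 : ((m + n : ℕ) : ℤ) + m = ((m + n + m : ℕ) : ℤ) := by push_cast; ring
    have h2 : ((m + n : ℕ) : ℤ) - m = (n : ℤ) := by push_cast; ring
    simp only [baileyMatrix, h1, h2, ellPoch_natCast, zpow_natCast]
  have hval : ellGamma p q (k * q ^ (m + n + m)) * ellGamma p q (k / a * q ^ n) *
        ((qPochInf p p * qPochInf q q)⁻¹ / ∏ j ∈ Finset.range n, theta ((q ^ n)⁻¹ * q ^ j) p) *
        ellGamma p q (a * q ^ (2 * m + n))⁻¹ / (ellGamma p q (k / a) *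
          (ellGamma p q (a * q ^ (2 * m)) * ellGamma p q (a * q ^ (2 * m))⁻¹)) =
      (qPochInf p p * qPochInf q q)⁻¹ * (q ^ ((m + n) * (m + n + 1)) *
        (baileyMatrix p q a k (m + n) m * ((q ^ (m * (m + 1)))⁻¹ *
          (ellGamma p q k / ellGamma p q a)))) := by
    rw [g1, g2, g5, g6, hbailey]
    have hq' : q ^ (m * (m + 1)) ≠ 0 := pow_ne_zero _ hq0
    have hq'' : q ^ ((m + n) * (m + n + 1)) ≠ 0 := pow_ne_zero _ hq0
    have han : a ^ n ≠ 0 := pow_ne_zero _ ha0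
    have hTqa : ∏ j ∈ Finset.range (m + n + m), theta (q * a * q ^ j) p ≠ 0 := fun h => by
      rw [h, mul_zero] at hS
      exact mul_ne_zero (mul_ne_zero hT5 hθ2) hY hS.symm
    have hT6 : ∏ j ∈ Finset.range n, theta ((a * q ^ (2 * m + n))⁻¹ * q ^ j) p ≠ 0 := by
      rw [Finset.prod_ne_zero_iff]
      intro j hj
      have hj := Finset.mem_range.1 hj
      have hja : (a * q ^ (2 * m + n))⁻¹ * q ^ j = (a * q ^ (2 * m + n - j))⁻¹ := by
        rw [show q ^ (2 * m + n) = q ^ (2 * m + n - j) * q ^ j by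
          rw [← pow_add]; congr 1; omega]
        field_simp
      rw [hja, theta_inv hp (haq0 _)]
      exact mul_ne_zero (neg_ne_zero.2 (inv_ne_zero (haq0 _))) (hθa _ (by omega))
    have hTq : ∏ j ∈ Finset.range n, theta (q * q ^ j) p ≠ 0 := fun h => by
      rw [h, mul_zero, zero_mul] at hR
      exact mul_ne_zero (mul_ne_zero hD3 hT6) (mul_ne_zero han hq'') hR
    have hpp := qPochInf_self_ne_zero hp
    have hqq := qPochInf_self_ne_zero hq
    have hΓa : ellGamma p q a ≠ 0 := ellGamma_ne_zero hp hq ha0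
      (mul_pow_mul_pow_ne_one hp hq ha1) fun i j h =>
        ha' 0 (by omega) (i + 1) (j + 1) (by rw [pow_zero, mul_one, h])
    generalize ∏ j ∈ Finset.range (m + n + m), theta (k * q ^ j) p = T1 at *
    generalize ∏ j ∈ Finset.range n, theta (k / a * q ^ j) p = T2 at *
    generalize ∏ j ∈ Finset.range n, theta ((q ^ n)⁻¹ * q ^ j) p = D3 at *
    generalize ∏ j ∈ Finset.range (2 * m), theta (a * q ^ j) p = T5 at *
    generalize ∏ j ∈ Finset.range n, theta ((a * q ^ (2 * m + n))⁻¹ * q ^ j) p = T6 at *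
    generalize ∏ j ∈ Finset.range n, theta (a * q ^ (2 * m + 1 + j)) p = Y at *
    generalize ∏ j ∈ Finset.range (m + n + m), theta (q * a * q ^ j) p = Tqa at *
    generalize ∏ j ∈ Finset.range n, theta (q * q ^ j) p = Tq at *
    generalize ellGamma p q (k / a) = Γka at *
    generalize ellGamma p q k = Γk at *
    generalize ellGamma p q a = Γa at *
    generalize ellGamma p q (a * q ^ (2 * m + n))⁻¹ = Γ4 at *
    generalize theta (a * q ^ (2 * m)) p = θ2 at *
    generalize theta a p = θ0 at *
    generalize q ^ ((m + n) * (m + n + 1)) = Q1 at *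
    generalize q ^ (m * (m + 1)) = Q2 at *
    generalize a ^ n = an at *
    generalize qPochInf p p = Pp at *
    generalize qPochInf q q = Pq at *
    -- `hR` converts the thetas of inverse arguments, and `hS` completes the remaining products to
    -- the denominator of the matrix entry.
    have key : (D3 * T5 * T6)⁻¹ = Q1 * an * θ2 / (θ0 * Tqa * Tq * Q2) := by
      rw [inv_eq_one_div, div_eq_div_iff (by positivity) (by positivity)]
      rw [hS]
      linear_combination (-(T5 * θ2)) * hR
    calc _ = T1 * T2 * (Γk / Γa) * (Pp * Pq)⁻¹ * (D3 * T5 * T6)⁻¹ := by field_simp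
      _ = _ := by
        rw [key]
        field_simp
  rw [hval] at hlim
  refine hlim.congr' ?_
  filter_upwards [nhdsWithin_le_nhds (isOpen_ne.mem_nhds (one_ne_zero : (1 : ℂ) ≠ 0))] with ε hε
  rw [kernel_at_pole hq0 hra0 hrk0 hε]
  ring

/-- For negative index θ(q)_{n-m} contains the factor 1/θ(1; p), which evaluates to 0, and division
by that 0 gives 0 again: the value prescribed by reading 1/θ(q)_{n-m} as a product containing θ(1;
p). -/
theorem baileyMatrix_eq_zero (hp : ‖p‖ < 1) (hq0 : q ≠ 0) (a k : ℂ) {n m : ℕ} (h : n < m) :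
    baileyMatrix p q a k n m = 0 := by
  obtain ⟨l, rfl⟩ := Nat.exists_eq_add_of_lt h
  have hz : ((n : ℤ) - ((n + l + 1 : ℕ) : ℤ)) = Int.negSucc l := by
    rw [Int.negSucc_eq]
    push_cast
    ring
  have h0 : ellPoch p q q (Int.negSucc l) = 0 := by
    refine Finset.prod_eq_zero (i := 1) (by simp) ?_
    rw [pow_one, mul_inv_cancel₀ hq0, theta_one hp, inv_zero]
  rw [baileyMatrix, hz, h0]
  simp

end KernelLimit

end EllipticBailey

end

/-! ### Genericity at and near the pinching point -/

noncomputable section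

namespace EllipticBailey

section Pinching

variable {p q : ℂ}

/-- The set of the points `z₀ q^m`, `m = 0, …, N`, as a finset. -/
def seqPolesFinset (q z₀ : ℂ) (N : ℕ) : Finset ℂ :=
  (Finset.range (N + 1)).image fun m => z₀ * q ^ m

theorem coe_seqPolesFinset (q z₀ : ℂ) (N : ℕ) :
    (seqPolesFinset q z₀ N : Set ℂ) = seqPoles q z₀ N := by
  ext w
  simp [seqPolesFinset, seqPoles, eq_comm]

theorem injective_mul_pow (hq0 : q ≠ 0) (hq : ‖q‖ < 1) {z₀ : ℂ} (hz₀ : z₀ ≠ 0) :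
    Function.Injective fun m : ℕ => z₀ * q ^ m := by
  intro m n h
  have h1 : ‖q‖ ^ m = ‖q‖ ^ n := by
    rw [← norm_pow, ← norm_pow, mul_left_cancel₀ hz₀ h]
  exact (pow_right_strictAnti₀ (norm_pos_iff.2 hq0) hq).injective h1

theorem norm_lt_one_of_mem_seqPoles (hq : ‖q‖ < 1) {z₀ : ℂ} (hz₀ : ‖z₀‖ < 1) {N : ℕ} {w : ℂ}
    (hw : w ∈ seqPoles q z₀ N) : ‖w‖ < 1 := by
  obtain ⟨m, _, rfl⟩ := hw
  rw [norm_mul, norm_pow]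
  exact mul_lt_one_of_nonneg_of_lt_one_left (norm_nonneg _) hz₀
    (pow_le_one₀ (norm_nonneg _) hq.le)

theorem zero_notMem_seqPoles (hq0 : q ≠ 0) {z₀ : ℂ} (hz₀ : z₀ ≠ 0) (N : ℕ) :
    (0 : ℂ) ∉ seqPoles q z₀ N := by
  rintro ⟨m, _, h⟩
  exact mul_ne_zero hz₀ (pow_ne_zero m hq0) h.symm

theorem inv_notMem_seqPoles (hq0 : q ≠ 0) (hq : ‖q‖ < 1) {z₀ : ℂ} (hz₀0 : z₀ ≠ 0)
    (hz₀ : ‖z₀‖ < 1) {N : ℕ} {w : ℂ} (hw : w ∈ seqPoles q z₀ N) : w⁻¹ ∉ seqPoles q z₀ N := by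
  intro h
  have h1 := norm_lt_one_of_mem_seqPoles hq hz₀ hw
  have h2 := norm_lt_one_of_mem_seqPoles hq hz₀ h
  have h0 : w ≠ 0 := fun h => zero_notMem_seqPoles hq0 hz₀0 N (h ▸ hw)
  rw [norm_inv] at h2
  exact (one_lt_inv₀ (norm_pos_iff.2 h0)).2 h1 |>.not_gt h2

/-- At the pinching point the reciprocals of the poles of `α` are poles of the kernel. -/
theorem inv_mem_kernelPoles_of_mem_seqPoles (hq0 : q ≠ 0) {ra rk : ℂ} (hrk : rk ≠ 0) {N : ℕ}
    {w : ℂ} (hw : w ∈ seqPoles q ra N) : w⁻¹ ∈ kernelPoles p q (rk / ra) (rk * q ^ N) := by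
  obtain ⟨m, hm, rfl⟩ := hw
  obtain ⟨n, rfl⟩ := Nat.exists_eq_add_of_le hm
  refine ⟨n, 0, Or.inr ?_⟩
  rw [pow_zero, mul_one, pow_add]
  field_simp

/-- At the pinching point no pole of the kernel is the reciprocal of another one. -/
theorem inv_notMem_kernelPoles_of_generic (hp0 : p ≠ 0) (hq0 : q ≠ 0) {ra rk : ℂ} (hra : ra ≠ 0)
    (hrk : rk ≠ 0) {N : ℕ} (hka : ∀ i j : ℕ, rk ^ 2 / ra ^ 2 * q ^ i * p ^ j ≠ 1)
    (ha : ∀ i j : ℕ, ra ^ 2 * q ^ (2 * N) ≠ q ^ i * p ^ j)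
    (hkk : ∀ i j : ℕ, (rk ^ 2) ^ 2 * q ^ (2 * N) * q ^ i * p ^ j ≠ ra ^ 2) {w : ℂ}
    (hw : w ∈ kernelPoles p q (rk / ra) (rk * q ^ N)) :
    w⁻¹ ∉ kernelPoles p q (rk / ra) (rk * q ^ N) := by
  intro hw'
  have h0 : w ≠ 0 := fun h => zero_notMem_kernelPoles hp0 hq0 (div_ne_zero hrk hra)
    (mul_ne_zero hrk (pow_ne_zero N hq0)) (h ▸ hw)
  obtain ⟨i, j, h⟩ := hw
  obtain ⟨i', j', h'⟩ := hw'
  have hmul : w * w⁻¹ = 1 := mul_inv_cancel₀ h0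
  have hmixed : ∀ u v : ℂ, u = rk / ra * (rk * q ^ N) → v = rk / ra * (rk * q ^ N)⁻¹ →
      u * v * q ^ (i + i') * p ^ (j + j') ≠ 1 := by
    rintro u v rfl rfl h
    refine hka (i + i') (j + j') ?_
    rw [← h]
    field_simp
  -- Two poles with x would violate the condition on k² q^(2N), two with x⁻¹ the one on a q^(2N),
  -- and a mixed pair the one on k/a.
  rcases h with h | h <;> rcases h' with h' | h' <;> rw [h', h] at hmul
  · refine hkk (i + i') (j + j') ?_
    have : (rk ^ 2) ^ 2 * q ^ (2 * N) * q ^ (i + i') * p ^ (j + j') = ra ^ 2 *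
        (rk / ra * (rk * q ^ N) * q ^ i * p ^ j * (rk / ra * (rk * q ^ N) * q ^ i' * p ^ j')) := by
      field_simp
      ring
    rw [this, hmul, mul_one]
  · exact hmixed _ _ rfl rfl (by rw [← hmul]; ring)
  · exact hmixed _ _ rfl rfl (by rw [← hmul]; ring)
  · refine ha (i + i') (j + j') ?_
    have : q ^ (i + i') * p ^ (j + j') = ra ^ 2 * q ^ (2 * N) *
        (rk / ra * (rk * q ^ N)⁻¹ * q ^ i * p ^ j *
          (rk / ra * (rk * q ^ N)⁻¹ * q ^ i' * p ^ j')) := by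
      field_simp
      ring
    rw [this, hmul, mul_one]

/-- Close to the pinching point the reciprocals of the poles of `α` are not poles of the kernel. -/
theorem eventually_inv_notMem_kernelPoles (hp : ‖p‖ < 1) (hq : ‖q‖ < 1)
    (hq0 : q ≠ 0) {ra rk : ℂ} (hra : ra ≠ 0) (hrk : rk ≠ 0) (N : ℕ) :
    ∀ᶠ ε in 𝓝[≠] (1 : ℂ), ∀ w ∈ seqPoles q ra N,
      w⁻¹ ∉ kernelPoles p q (rk / ra) (ε⁻¹ * (rk * q ^ N)) := by
  -- A coincidence with the first family of kernel poles forces the first equation for ε, one with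
  -- the second family the second. The second does hold at ε = 1, where the contour is pinched, but
  -- neither holds for nearby ε ≠ 1.
  have hev : ∀ᶠ ε in 𝓝[≠] (1 : ℂ), ∀ m ∈ Finset.range (N + 1),
      (∀ i j : ℕ, ε ≠ rk ^ 2 * q ^ N * q ^ m * q ^ i * p ^ j) ∧
        ∀ i j : ℕ, ε⁻¹ ≠ q ^ m * (q ^ N)⁻¹ * q ^ i * p ^ j :=
    (Filter.eventually_all_finset _).2 fun m _ =>
      (eventually_ne_mul_pow_mul_pow hp hq _).and
        (tendsto_inv_punctured_one.eventually (eventually_ne_mul_pow_mul_pow hp hq _))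
  filter_upwards [hev, nhdsWithin_le_nhds (isOpen_ne.mem_nhds (one_ne_zero : (1 : ℂ) ≠ 0))]
    with ε hε hε0
  have hε0 : ε ≠ 0 := hε0
  rintro _ ⟨m, hm, rfl⟩ ⟨i, j, h | h⟩
  · refine (hε m (Finset.mem_range.2 (by omega))).1 i j ?_
    field_simp at h
    rw [h]
    ring
  · refine (hε m (Finset.mem_range.2 (by omega))).2 i j ?_
    have hc : ra * q ^ m * (rk / ra * (ε⁻¹ * (rk * q ^ N))⁻¹ * q ^ i * p ^ j) = 1 := by
      rw [← h, mul_inv_cancel₀ (mul_ne_zero hra (pow_ne_zero m hq0))]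
    refine inv_eq_of_mul_eq_one_right ?_
    rw [← hc]
    field_simp

/-- The residue sum is stated with `kernel` itself, so its values at z₀ q^m must be those of the
continuation. A zero of the double product at pq/w² would give a q^(2N) = q^(2n+1+j) p^(1+i) with n
= N - m. -/
theorem notMem_kernelExceptional_of_mem_seqPoles (hp : ‖p‖ < 1) (hq : ‖q‖ < 1) (hq0 : q ≠ 0)
    {ra : ℂ} (hra0 : ra ≠ 0) (hra : ‖ra‖ < 1) {N : ℕ}
    (ha : ∀ i j : ℕ, ra ^ 2 * q ^ (2 * N) ≠ q ^ i * p ^ j) {w : ℂ} (hw : w ∈ seqPoles q ra N) :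
    w ∉ kernelExceptional p q := by
  have hw1 := norm_lt_one_of_mem_seqPoles hq hra hw
  have hw0 : w ≠ 0 := fun h => zero_notMem_seqPoles hq0 hra0 N (h ▸ hw)
  rintro (h | h)
  · refine doublePochInf_ne_zero_of_norm_lt_one hp hq ?_ h
    rw [norm_mul, norm_mul, norm_pow]
    exact mul_lt_one_of_nonneg_of_lt_one_right
      (mul_le_one₀ hp.le (norm_nonneg _) hq.le) (by positivity)
      (pow_lt_one₀ (norm_nonneg _) hw1 two_ne_zero)
  · obtain ⟨i, j, hij⟩ := (doublePochInf_eq_zero_iff hp hq _).1 h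
    obtain ⟨m, hm, rfl⟩ := hw
    obtain ⟨n, rfl⟩ := Nat.exists_eq_add_of_le hm
    refine ha (2 * n + 1 + j) (1 + i) ?_
    field_simp at hij
    have : ra ^ 2 * q ^ (2 * (m + n)) = q ^ (2 * n) * (ra ^ 2 * (q ^ m) ^ 2) := by ring
    rw [this, ← hij]
    ring

end Pinching

end EllipticBailey

end

/-! ### The main theorem -/

theorem mainTheorem1 (p q : ℂ) (hp0 : p ≠ 0) (hp1 : ‖p‖ < 1) (hq0 : q ≠ 0) (hq1 : ‖q‖ < 1)
    (N : ℕ) (hpq : ∀ i j : ℕ, 1 ≤ i → i ≤ N → q ^ i ≠ p ^ j)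
    (a k ra rk z₀ t : ℂ) (x : ℂ → ℂ)
    (hra : ra ^ 2 = a) (hrk : rk ^ 2 = k) (ha0 : a ≠ 0) (hk0 : k ≠ 0)
    (hz₀ : z₀ = ra) (ht : t = rk / ra) (hx : ∀ ε, x ε = ε⁻¹ * rk * q ^ N)
    (hz₀1 : ‖z₀‖ < 1)
    (hka : ∀ i j : ℕ, k / a * q ^ i * p ^ j ≠ 1)
    (hka' : ∀ i j : ℕ, k / a ≠ q ^ (i + 1) * p ^ (j + 1))
    (hk : ∀ i j : ℕ, k * q ^ i * p ^ j ≠ 1)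
    (ha : ∀ i j : ℕ, a * q ^ (2 * N) ≠ q ^ i * p ^ j)
    (hkk : ∀ i j : ℕ, k ^ 2 * q ^ (2 * N) * q ^ i * p ^ j ≠ a)
    (α : ℂ → ℂ) (αt : ℕ → ℂ) (A : Set ℂ) (hA : A = EllipticBailey.seqPoles q z₀ N)
    (hαsymm : ∀ z : ℂ, z ≠ 0 → z ∉ A → z⁻¹ ∉ A → α z⁻¹ = α z)
    (hαdiff : DifferentiableOn ℂ α {z | z ≠ 0 ∧ z ∉ A ∧ z⁻¹ ∉ A})
    (hαt : ∀ m ≤ N, Tendsto (fun z => (1 - z₀ * q ^ m / z) * α z)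
      (𝓝[≠] (z₀ * q ^ m)) (𝓝 (αt m))) :
    -- near the pinching point the transform of `α` is defined, independently of the contour
    (∀ᶠ ε in 𝓝[≠] (1 : ℂ), ∃! b, EllipticBailey.IsEFT p q t (x ε) A α b) ∧
    -- the contour can be deformed across the poles of `α` uniformly near `ε = 1`; the deformation
    -- produces the residue sum, and the integral part is killed by the factor `1 - ε`
    (∃ C, EllipticBailey.IsDeformedContour p q t (x 1) A C) ∧
    (∀ C, EllipticBailey.IsDeformedContour p q t (x 1) A C →
      (∀ᶠ ε in 𝓝[≠] (1 : ℂ), EllipticBailey.IsDeformedContour p q t (x ε) A C ∧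
        ∀ b, EllipticBailey.IsEFT p q t (x ε) A α b →
          b = EllipticBailey.eftIntegral p q t (x ε) α C +
            4 * Real.pi * Complex.I * EllipticBailey.kappa p q *
              ∑ m ∈ Finset.range (N + 1),
                EllipticBailey.kernel p q t (x ε) (z₀ * q ^ m) * αt m) ∧
      Tendsto (fun ε => (1 - ε) * EllipticBailey.eftIntegral p q t (x ε) α C)
        (𝓝[≠] (1 : ℂ)) (𝓝 0)) ∧
    -- the limit exists and the renormalized sequences satisfy the matrix relation
    (∀ β : ℂ → ℂ, (∀ᶠ ε in 𝓝[≠] (1 : ℂ), EllipticBailey.IsEFT p q t (x ε) A α (β ε)) →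
      ∃ βt : ℂ, Tendsto (fun ε => (1 - ε) * β ε) (𝓝[≠] (1 : ℂ)) (𝓝 βt) ∧
        βt * (q ^ (N * (N + 1)))⁻¹ =
          ∑ m ∈ Finset.range (N + 1), EllipticBailey.baileyMatrix p q a k N m *
            (αt m * (q ^ (m * (m + 1)))⁻¹ *
              (EllipticBailey.ellGamma p q k / EllipticBailey.ellGamma p q a))) ∧
    -- the matrix is triangular
    (∀ n m : ℕ, n < m → EllipticBailey.baileyMatrix p q a k n m = 0) := by
  subst hra hrk hA hz₀ ht
  have hz0 : z₀ ≠ 0 := fun h => ha0 (by rw [h, zero_pow two_ne_zero])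
  have hrk0 : rk ≠ 0 := fun h => hk0 (by rw [h, zero_pow two_ne_zero])
  have ht0 : rk / z₀ ≠ 0 := div_ne_zero hrk0 hz0
  have hx0 : rk * q ^ N ≠ 0 := mul_ne_zero hrk0 (pow_ne_zero N hq0)
  obtain rfl : x = fun ε => ε⁻¹ * (rk * q ^ N) := funext fun ε => by rw [hx, mul_assoc]
  simp only [inv_one, one_mul]
  set A := EllipticBailey.seqPoles q z₀ N
  set t := rk / z₀
  set x₁ := rk * q ^ N
  have hAfin : A.Finite := by
    have h := (EllipticBailey.seqPolesFinset q z₀ N).finite_toSet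
    rwa [EllipticBailey.coe_seqPolesFinset] at h
  have hA0 : (0 : ℂ) ∉ A := EllipticBailey.zero_notMem_seqPoles hq0 hz0 N
  have hα : ∀ z, z ≠ 0 → z ∉ A → z⁻¹ ∉ A → DifferentiableAt ℂ α z := fun z h0 h1 h2 => by
    refine (hαdiff z ⟨h0, h1, h2⟩).differentiableAt ?_
    have hcl := (((Set.finite_singleton (0 : ℂ)).union hAfin).union
      (hAfin.preimage (f := fun z : ℂ => z⁻¹) inv_injective.injOn)).isClosed
    filter_upwards [hcl.isOpen_compl.mem_nhds (x := z) (by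
      rintro ((h | h) | h)
      exacts [h0 h, h1 h, h2 h])] with w hw
    exact ⟨fun h => hw (Or.inl (Or.inl h)), fun h => hw (Or.inl (Or.inr h)),
      fun h => hw (Or.inr h)⟩
  have hdef : ∃ C, EllipticBailey.IsDeformedContour p q t x₁ A C :=
    EllipticBailey.exists_isDeformedContour hp0 hp1 hq0 hq1 ht0 hx0
      (fun w hw => EllipticBailey.inv_mem_kernelPoles_of_mem_seqPoles hq0 hrk0 hw)
      fun w hw => EllipticBailey.inv_notMem_kernelPoles_of_generic hp0 hq0 hz0 hrk0 hka ha hkk hw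
  have hε0 : ∀ᶠ ε in 𝓝[≠] (1 : ℂ), ε⁻¹ * x₁ ≠ 0 := by
    filter_upwards [nhdsWithin_le_nhds (isOpen_ne.mem_nhds (one_ne_zero : (1 : ℂ) ≠ 0))] with ε hε
    exact mul_ne_zero (inv_ne_zero hε) hx0
  have hresidue : ∀ C, EllipticBailey.IsDeformedContour p q t x₁ A C →
      ∀ᶠ ε in 𝓝[≠] (1 : ℂ), EllipticBailey.IsDeformedContour p q t (ε⁻¹ * x₁) A C ∧
        ∀ b, EllipticBailey.IsEFT p q t (ε⁻¹ * x₁) A α b →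
          b = EllipticBailey.eftIntegral p q t (ε⁻¹ * x₁) α C +
            4 * Real.pi * Complex.I * EllipticBailey.kappa p q *
              ∑ m ∈ Finset.range (N + 1),
                EllipticBailey.kernel p q t (ε⁻¹ * x₁) (z₀ * q ^ m) * αt m := by
    intro C hC
    filter_upwards [nhdsWithin_le_nhds (hC.eventually hp0 hp1 hq0 hq1 ht0 hx0), hε0]
      with ε hε hε0
    refine ⟨hε, ?_⟩
    rintro _ ⟨C', hC', rfl⟩
    have hinj := EllipticBailey.injective_mul_pow hq0 hq1 hz0
    have hAF : A = (EllipticBailey.seqPolesFinset q z₀ N : Set ℂ) :=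
      (EllipticBailey.coe_seqPolesFinset q z₀ N).symm
    have hmem : ∀ w, w ∈ EllipticBailey.seqPolesFinset q z₀ N ↔ w ∈ A := fun w => by
      rw [hAF, Finset.mem_coe]
    -- The residue formula sums over poles rather than indices; the points z₀ q^m are distinct, so
    -- αt extends along m ↦ z₀ q^m.
    rw [EllipticBailey.eftIntegral_eq_add_residues hp0 hp1 hq0 hq1 ht0 hε0
      (A := EllipticBailey.seqPolesFinset q z₀ N)
      (r := Function.extend (fun m : ℕ => z₀ * q ^ m) αt 0) (C := C') (C' := C)]
    · rw [EllipticBailey.seqPolesFinset, Finset.sum_image hinj.injOn]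
      simp only [hinj.extend_apply]
    · rwa [hmem]
    · simpa only [hmem] using hα
    · simpa only [hmem] using hαsymm
    · intro s hs
      obtain ⟨m, hm, rfl⟩ := (hmem s).1 hs
      rw [hinj.extend_apply αt 0 m]
      exact hαt m hm
    · exact fun s hs => EllipticBailey.notMem_kernelExceptional_of_mem_seqPoles hp1 hq1 hq0 hz0
        hz₀1 ha ((hmem s).1 hs)
    · rwa [← hAF]
    · rwa [← hAF]
  have htend : ∀ C, EllipticBailey.IsDeformedContour p q t x₁ A C →
      Tendsto (fun ε => (1 - ε) * EllipticBailey.eftIntegral p q t (ε⁻¹ * x₁) α C)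
        (𝓝[≠] (1 : ℂ)) (𝓝 0) := fun C hC =>
    EllipticBailey.tendsto_one_sub_mul_eftIntegral hp1 hq1 ht0 hx0 hα hC
  obtain ⟨C₀, hC₀⟩ := hdef
  refine ⟨?_, ⟨C₀, hC₀⟩, fun C hC => ⟨hresidue C hC, htend C hC⟩, ?_, fun n m h =>
    EllipticBailey.baileyMatrix_eq_zero hp1 hq0 _ _ h⟩
  · filter_upwards [nhdsWithin_le_nhds (hC₀.eventually hp0 hp1 hq0 hq1 ht0 hx0), hε0,
      EllipticBailey.eventually_inv_notMem_kernelPoles hp1 hq1 hq0 hz0 hrk0 N] with ε hε hε0 hεA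
    -- Two kernel poles cannot be reciprocal because the deformed contour still separates them at ε;
    -- mixed pairs are excluded by ε ≠ 1 near 1, and pairs from A by |z₀| < 1.
    obtain ⟨C, hC⟩ := EllipticBailey.exists_isDefiningContour hp0 hp1 hq0 hq1 ht0 hε0 hAfin hA0 (by
      rintro w (hw | hw) (hw' | hw')
      · have h1 := (hε.1 w (Or.inl (Or.inr hw))).2
        rw [(hε.2 w (Or.inl hw')).2] at h1
        exact zero_ne_one h1
      · exact hεA _ hw' (by rwa [inv_inv])
      · exact hεA _ hw hw'
      · exact EllipticBailey.inv_notMem_seqPoles hq0 hq1 hz0 hz₀1 hw hw')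
    refine ⟨_, ⟨C, hC, rfl⟩, ?_⟩
    rintro _ ⟨C', hC', rfl⟩
    exact EllipticBailey.eftIntegral_eq_of_isDefiningContour hp0 hp1 hq0 hq1 ht0 hε0 hAfin hA0 hα
      hC' hC
  · intro β hβ
    -- This constant is the inverse of the residue factor of Γ at 1, which is why κ is normalized as
    -- it is.
    have hκ : 4 * Real.pi * Complex.I * EllipticBailey.kappa p q =
        EllipticBailey.qPochInf p p * EllipticBailey.qPochInf q q := by
      rw [EllipticBailey.kappa, mul_div_cancel₀]
      simp [Real.pi_ne_zero]
    have hPne : EllipticBailey.qPochInf p p * EllipticBailey.qPochInf q q ≠ 0 :=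
      mul_ne_zero (EllipticBailey.qPochInf_self_ne_zero hp1)
        (EllipticBailey.qPochInf_self_ne_zero hq1)
    have hK : ∀ m ∈ Finset.range (N + 1), Tendsto (fun ε => (1 - ε) *
        EllipticBailey.kernel p q t (ε⁻¹ * x₁) (z₀ * q ^ m)) (𝓝[≠] (1 : ℂ))
        (𝓝 ((EllipticBailey.qPochInf p p * EllipticBailey.qPochInf q q)⁻¹ * (q ^ (N * (N + 1)) *
          (EllipticBailey.baileyMatrix p q (z₀ ^ 2) (rk ^ 2) N m * ((q ^ (m * (m + 1)))⁻¹ *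
            (EllipticBailey.ellGamma p q (rk ^ 2) / EllipticBailey.ellGamma p q (z₀ ^ 2))))))) :=
          fun m hm => by
      obtain ⟨n, rfl⟩ := Nat.exists_eq_add_of_le (Nat.lt_succ_iff.1 (Finset.mem_range.1 hm))
      exact EllipticBailey.tendsto_one_sub_mul_kernel hp1 hq1 hq0 hz0 hrk0 hz₀1 m n
        (fun i j h1 h2 => hpq i j h1 (by omega)) hka hka' hk ha
    have hlim := (htend C₀ hC₀).add ((tendsto_finsetSum _ fun m hm =>
      (hK m hm).mul_const (αt m)).const_mul
        (EllipticBailey.qPochInf p p * EllipticBailey.qPochInf q q))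
    refine ⟨_, hlim.congr' ?_, ?_⟩
    · filter_upwards [hβ, hresidue C₀ hC₀] with ε h1 h2
      rw [h2.2 _ h1, hκ, mul_add, mul_left_comm (1 - ε)]
      simp only [mul_assoc (1 - ε), ← Finset.mul_sum]
    · have hqN : q ^ (N * (N + 1)) ≠ 0 := pow_ne_zero _ hq0
      rw [zero_add, Finset.mul_sum, Finset.sum_mul]
      refine Finset.sum_congr rfl fun m _ => ?_
      generalize EllipticBailey.qPochInf p p * EllipticBailey.qPochInf q q = c at hPne ⊢
      field_simp
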